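/- Let $\mathbb K\in\{\mathbb R,\mathbb C\}$, let $E$ be a locally compact Hausdorff space with Borel $\sigma$-algebra $\mathcal B(E)$, and let $C_0(E)$ be the Banach space (with the supremum norm) of continuous functions $f\colon E\to\mathbb K$ that vanish at infinity. Let $\mathcal M(E)$ be the space of finite signed (if $\mathbb K=\mathbb R$) or complex (if $\mathbb K=\mathbb C$) Radon measures on $\mathcal B(E)$, i.e. those $\mu$ such that for every $A\in\mathcal B(E)$ and $\varepsilon>0$ there is a compact $K\subseteq A$ with $|\mu|(A\setminus K)\le\varepsilon$, normed by $\|\mu\|_{\mathrm{TV}}=|\mu|(E)$, where $|\mu|$ is the total variation measure of $\mu$. A kernel on $E$ is a map $k\colon E\times\mathcal B(E)\to\mathbb K$ such that $k(\cdot,A)$ is Borel measurable for every $A\in\mathcal B(E)$, $k(x,\cdot)\in\mathcal M(E)$ for every $x\in E$, and $\sup_{x\in E}\|k(x,\cdot)\|_{\mathrm{TV}}<\infty$. A bounded linear operator $T$ on $C_0(E)$ is a kernel operator if there is a kernel $k$ on $E$ with $$(Tf)(x)=\int_E f(y)\,k(x,\mathrm dy)\qquad\text{for all } f\in C_0(E),\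 x\in E.$$ Let $T$ be a bounded linear operator on $C_0(E)$. There is at most one kernel $k$ with this property; if there is one, it is called the kernel associated with $T$. Moreover, the following hold. (a) $T$ is weakly compact (it maps bounded sets to relatively weakly compact sets) if and only if $T$ is a kernel operator and its associated kernel $k$ satisfies $k(\cdot,A)\in C_0(E)$ for all $A\in\mathcal B(E)$. (b) $T$ is compact (it maps bounded sets to relatively norm-compact sets) if and only if $T$ is a kernel operator and its associated kernel $k$ is such that $x\mapsto k(x,\cdot)$ is continuous from $E$ to $(\mathcal M(E),\|\cdot\|_{\mathrm{TV}})$ and $x\mapsto\|k(x,\cdot)\|_{\mathrm{TV}}$ belongs to $C_0(E)$. -/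

import Mathlib

open MeasureTheory Filter Topology
open scoped ZeroAtInfty ENNReal

/-- A (finite signed or complex) Borel measure `μ` is a Radon measure if every Borel set can be
approximated from inside by compact sets with respect to the total variation `|μ|`. -/
def IsRadonMeasure {𝕜 : Type*} [RCLike 𝕜] {E : Type*} [TopologicalSpace E] [MeasurableSpace E]
    (μ : VectorMeasure E 𝕜) : Prop :=
  ∀ A : Set E, MeasurableSet A → ∀ ε : ℝ≥0∞, 0 < ε →
    ∃ K : Set E, K ⊆ A ∧ IsCompact K ∧ μ.variation (A \ K) ≤ ε

/-- A kernel on `E`: a family `k x` of finite (signed or complex) Radon measures with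
`x ↦ k x A` Borel measurable for every Borel set `A`, and `sup_x |k x|(E) < ∞`. -/
@[ext]
structure BoundedKernel (𝕜 : Type*) [RCLike 𝕜] (E : Type*) [TopologicalSpace E]
    [MeasurableSpace E] where
  /-- The measure `k(x, ·)`. -/
  toMeasure : E → VectorMeasure E 𝕜
  measurable_apply : ∀ A : Set E, MeasurableSet A → Measurable fun x => toMeasure x A
  radon : ∀ x, IsRadonMeasure (toMeasure x)
  bounded : (⨆ x, (toMeasure x).variation Set.univ) < ∞

/-- `T f (x) = ∫ f(y) k(x, dy)` for all `f ∈ C₀(E)` and `x ∈ E`: the operator `T` is the kernel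
operator associated with the kernel `k`. -/
def IsKernelOf {𝕜 : Type*} [RCLike 𝕜] {E : Type*} [TopologicalSpace E] [MeasurableSpace E]
    (k : BoundedKernel 𝕜 E) (T : C₀(E, 𝕜) →L[𝕜] C₀(E, 𝕜)) : Prop :=
  ∀ (f : C₀(E, 𝕜)) (x : E),
    T f x = (k.toMeasure x).integral (fun y => f y) (ContinuousLinearMap.mul ℝ 𝕜)

/-- The total variation norm `‖μ‖_TV = |μ|(E)`. -/
noncomputable def tvNorm {𝕜 : Type*} [RCLike 𝕜] {E : Type*} [MeasurableSpace E]
    (μ : VectorMeasure E 𝕜) : ℝ :=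
  (μ.variation Set.univ).toReal

/-- `x ↦ k(x, ·)` is continuous for the total variation norm. -/
def BoundedKernel.IsTVContinuous {𝕜 : Type*} [RCLike 𝕜] {E : Type*} [TopologicalSpace E]
    [MeasurableSpace E] (k : BoundedKernel 𝕜 E) : Prop :=
  ∀ x, Tendsto (fun y => tvNorm (k.toMeasure y - k.toMeasure x)) (𝓝 x) (𝓝 0)

/-- The function `g` belongs to `C₀(E)`: it is continuous and vanishes at infinity. -/
def MemC0 {R : Type*} [TopologicalSpace R] [Zero R] {E : Type*} [TopologicalSpace E]
    (g : E → R) : Prop :=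
  ∃ f : C₀(E, R), ⇑f = g

/-- A bounded operator is weakly compact if it maps bounded sets to sets with compact closure in
the weak topology. -/
def IsWeaklyCompactOperator {𝕜 : Type*} [RCLike 𝕜] {X Y : Type*} [NormedAddCommGroup X]
    [NormedSpace 𝕜 X] [NormedAddCommGroup Y] [NormedSpace 𝕜 Y] (T : X →L[𝕜] Y) : Prop :=
  ∀ B : Set X, Bornology.IsBounded B → IsCompact (closure (toWeakSpace 𝕜 Y '' (T '' B)))

/-! By the Riesz theorem, f ↦ (T f)(x) is integration against a Radon measure κ(x) with ‖κ(x)‖_TV ≤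
‖T‖, so T always has a family of representing measures; what may fail is measurability in x. Riesz
is obtained by dominating a functional φ by a positive measure ρ, the Riesz–Markov measure of |φ|,
then extending φ to L¹(ρ) by Hahn–Banach (`exists_isRadonMeasure_eq_mulIntegral`). Density of C₀(E)
in L¹ with control of the sup norm gives uniqueness and identifies the TV norm with the dual norm
(`ext_of_mulIntegral`, `tvNorm_le`).

Weak compactness of T puts x ↦ κ(x)(A) in C₀(E): this function is a pointwise limit of T f with f in
the unit ball, and the weakly compact closure of the image is closed under pointwise limits
(`IsWeaklyCompactOperator.memC0`). Conversely, if all k(·,A) lie in C₀(E), then A ↦ ν(k(·,A)) is a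
measure for each functional ν, and bounded Borel functions g integrate to elements of C₀(E), so that
T extends to them. Failure of weak compactness produces functionals ν_m and points y_n = T f_n whose
iterated limits differ; a weak L² limit g of the f_n and a weak-star limit ψ of the ν_m make the two
limits agree, a contradiction (`IsKernelOf.isWeaklyCompactOperator`).

For compactness, the image of the unit ball is totally bounded exactly when it is equicontinuous and
uniformly small at infinity. By duality of the norms these are TV-continuity of the kernel and decay
of its TV norm. -/

open scoped NNReal CompactlySupported

/-! ### Scalar integrals against signed and complex measures. -/

section VectorIntegral

variable {𝕜 : Type*} [RCLike 𝕜] {X : Type*} [MeasurableSpace X]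

/-- The integral of a scalar function against a scalar measure, paired by multiplication. -/
noncomputable abbrev mulIntegral (μ : VectorMeasure X 𝕜) (f : X → 𝕜) : 𝕜 :=
  μ.integral f (ContinuousLinearMap.mul ℝ 𝕜)

theorem norm_mulIntegral_le (μ : VectorMeasure X 𝕜) (f : X → 𝕜) :
    ‖mulIntegral μ f‖ ≤ ∫ x, ‖f x‖ ∂μ.variation := by
  refine VectorMeasure.norm_integral_le_integral_norm.trans ?_
  exact mul_le_of_le_one_left (integral_nonneg fun _ => norm_nonneg _)
    (ContinuousLinearMap.opNorm_mul_le ℝ 𝕜)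

theorem norm_mulIntegral_le_of_bound (μ : VectorMeasure X 𝕜) [IsFiniteMeasure μ.variation]
    {f : X → 𝕜} {C : ℝ} (hC : ∀ x, ‖f x‖ ≤ C) :
    ‖mulIntegral μ f‖ ≤ C * tvNorm μ := by
  refine (norm_mulIntegral_le μ f).trans ?_
  refine (integral_mono_of_nonneg (.of_forall fun _ => norm_nonneg _)
    (integrable_const C) (.of_forall hC)).trans_eq ?_
  simp [tvNorm, Measure.real, mul_comm]

/-- The pairing `ContinuousLinearMap.mul ℝ 𝕜` is only real-bilinear, so homogeneity over 𝕜 needs the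
commutation of the set function with scalars. -/
theorem mulIntegral_const_mul (μ : VectorMeasure X 𝕜) (c : 𝕜) (f : X → 𝕜) :
    mulIntegral μ (fun x => c * f x) = c * mulIntegral μ f := by
  have := setToFun_smul (𝕜 := 𝕜) (dominatedFinMeasAdditive_cbmApplyMeasure μ
    (ContinuousLinearMap.mul ℝ 𝕜)) (fun c s x => by
      simp [VectorMeasure.transpose, mul_left_comm]) c f
  simpa [mulIntegral, VectorMeasure.integral_eq_setToFun] using! this

theorem mulIntegral_indicator (μ : VectorMeasure X 𝕜) [IsFiniteMeasure μ.variation]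
    {s : Set X} (hs : MeasurableSet s) (c : 𝕜) :
    mulIntegral μ (s.indicator fun _ => c) = c * μ s := by
  rw [mulIntegral, VectorMeasure.integral_indicator_const c hs]
  simp

theorem mulIntegral_sub (μ : VectorMeasure X 𝕜) {f g : X → 𝕜} (hf : Integrable f μ.variation)
    (hg : Integrable g μ.variation) :
    mulIntegral μ (fun x => f x - g x) = mulIntegral μ f - mulIntegral μ g :=
  VectorMeasure.integral_fun_sub hf hg

theorem mulIntegral_add (μ : VectorMeasure X 𝕜) {f g : X → 𝕜} (hf : Integrable f μ.variation)
    (hg : Integrable g μ.variation) :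
    mulIntegral μ (fun x => f x + g x) = mulIntegral μ f + mulIntegral μ g :=
  VectorMeasure.integral_fun_add hf hg

theorem norm_mulIntegral_sub_le (μ : VectorMeasure X 𝕜) {f g : X → 𝕜}
    (hf : Integrable f μ.variation) (hg : Integrable g μ.variation) :
    ‖mulIntegral μ f - mulIntegral μ g‖ ≤ ∫ x, ‖f x - g x‖ ∂μ.variation := by
  rw [← mulIntegral_sub μ hf hg]
  exact norm_mulIntegral_le _ _

/-- A functional of norm at most one on `L¹(ρ)` is the integral against a vector measure dominated
by `ρ`. -/
theorem exists_vectorMeasure_eq_of_strongDual_L1 (ρ : Measure X) [IsFiniteMeasure ρ]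
    (φ : StrongDual 𝕜 (Lp 𝕜 1 ρ)) (hφ : ‖φ‖ ≤ 1) :
    ∃ μ : VectorMeasure X 𝕜, μ.variation ≤ ρ ∧
      ∀ (f : X → 𝕜) (hf : MemLp f 1 ρ), mulIntegral μ f = φ (hf.toLp f) := by
  classical
  let m : Set X → 𝕜 := fun s => if hs : MeasurableSet s then
      φ (indicatorConstLp 1 hs (measure_ne_top ρ s) 1) else 0
  have hm : ∀ s, ‖m s‖ₑ ≤ ρ s := by
    intro s
    by_cases hs : MeasurableSet s
    · simp only [m, hs, dif_pos]
      rw [← ofReal_norm, ← ofReal_measureReal]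
      refine ENNReal.ofReal_le_ofReal ((φ.le_opNorm _).trans ?_)
      refine (mul_le_of_le_one_left (norm_nonneg _) hφ).trans_eq ?_
      rw [norm_indicatorConstLp one_ne_zero ENNReal.one_ne_top]
      simp
    · simp [m, hs]
  -- Domination by the finite measure ρ upgrades finite additivity of `m` to countable additivity.
  let μ : VectorMeasure X 𝕜 := VectorMeasure.of_additive_of_le_measure m hm
    (fun s t hs ht hst => by
      simp only [m, hs, ht, hs.union ht, dif_pos]
      rw [indicatorConstLp_disjoint_union hs ht (measure_ne_top ρ s) (measure_ne_top ρ t) hst,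
        map_add])
    (fun s hs => by simp [m, hs])
  have hμ : μ.variation ≤ ρ := VectorMeasure.variation_le_of_forall_enorm_le fun s _ => hm s
  have : IsFiniteMeasure μ.variation := isFiniteMeasure_of_le ρ hμ
  have hint : ∀ f : Lp 𝕜 1 ρ, Integrable f μ.variation := fun f =>
    (memLp_one_iff_integrable.1 (Lp.memLp f)).mono_measure hμ
  have key : ∀ f : Lp 𝕜 1 ρ, mulIntegral μ f = φ f := by
    intro f
    refine Lp.induction ENNReal.one_ne_top (fun f : Lp 𝕜 1 ρ => mulIntegral μ f = φ f)
      ?_ ?_ ?_ f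
    · intro c s hs hsρ
      have h1 : (Lp.simpleFunc.indicatorConst 1 hs hsρ.ne c : Lp 𝕜 1 ρ)
          = c • indicatorConstLp 1 hs (measure_ne_top ρ s) (1 : 𝕜) := by
        rw [Lp.simpleFunc.coe_indicatorConst]
        rw [indicatorConstLp, indicatorConstLp, ← MemLp.toLp_const_smul]
        congr 1
        ext x
        by_cases hx : x ∈ s <;> simp [hx]
      have h2 : (Lp.simpleFunc.indicatorConst 1 hs hsρ.ne c : Lp 𝕜 1 ρ) =ᵐ[μ.variation]
          s.indicator fun _ => c := by
        rw [Lp.simpleFunc.coe_indicatorConst]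
        exact (Measure.absolutelyContinuous_of_le hμ).ae_le indicatorConstLp_coeFn
      have h3 : μ s = m s := rfl
      rw [mulIntegral, VectorMeasure.integral_congr_ae h2, ← mulIntegral,
        mulIntegral_indicator μ hs, h1, map_smul, h3]
      simp [m, hs]
    · intro f g hf hg _ h1 h2
      have h3 : ((hf.toLp f + hg.toLp g : Lp 𝕜 1 ρ) : X → 𝕜) =ᵐ[μ.variation]
          fun x => hf.toLp f x + hg.toLp g x :=
        (Measure.absolutelyContinuous_of_le hμ).ae_le (Lp.coeFn_add _ _)
      rw [mulIntegral, VectorMeasure.integral_congr_ae h3, ← mulIntegral,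
        mulIntegral_add μ (hint _) (hint _), h1, h2, map_add]
    · refine isClosed_eq ?_ φ.continuous
      refine LipschitzWith.continuous (K := 1) (LipschitzWith.of_dist_le_mul fun f g => ?_)
      rw [dist_eq_norm]
      refine (norm_mulIntegral_sub_le μ (hint f) (hint g)).trans ?_
      rw [dist_eq_norm, L1.norm_eq_integral_norm, NNReal.coe_one, one_mul]
      have h3 : (fun x => ‖(f - g : Lp 𝕜 1 ρ) x‖) =ᵐ[ρ] fun x => ‖f x - g x‖ := by
        filter_upwards [Lp.coeFn_sub f g] with x hx
        rw [hx, Pi.sub_apply]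
      rw [integral_congr_ae h3]
      refine integral_mono_measure hμ (.of_forall fun _ => norm_nonneg _) ?_
      exact ((memLp_one_iff_integrable.1 (Lp.memLp f)).sub
        (memLp_one_iff_integrable.1 (Lp.memLp g))).norm
  refine ⟨μ, hμ, fun f hf => ?_⟩
  rw [← key, mulIntegral, mulIntegral]
  exact VectorMeasure.integral_congr_ae
    ((Measure.absolutelyContinuous_of_le hμ).ae_le hf.coeFn_toLp.symm)

/-- A bounded measurable scalar function is a uniform limit of simple functions. -/
theorem exists_simpleFunc_dist_le {f : X → 𝕜} (hf : Measurable f) {R : ℝ} (hR : ∀ x, ‖f x‖ ≤ R)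
    {δ : ℝ} (hδ : 0 < δ) : ∃ s : SimpleFunc X 𝕜, ∀ x, ‖f x - s x‖ ≤ δ := by
  let e := TopologicalSpace.denseSeq 𝕜
  have hcover : Metric.closedBall (0 : 𝕜) R ⊆ ⋃ n, Metric.ball (e n) δ := fun x _ => by
    obtain ⟨n, hn⟩ := (TopologicalSpace.denseRange_denseSeq 𝕜).exists_dist_lt x hδ
    exact Set.mem_iUnion.2 ⟨n, hn⟩
  obtain ⟨t, ht⟩ := (isCompact_closedBall (0 : 𝕜) R).elim_finite_subcover _
    (fun n => Metric.isOpen_ball) hcover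
  -- `nearestPt e N` minimises over all indices up to N, and N is the largest index of the subcover.
  refine ⟨(SimpleFunc.nearestPt e (t.sup id)).comp f hf, fun x => ?_⟩
  have hx : f x ∈ Metric.closedBall (0 : 𝕜) R := by simpa using hR x
  obtain ⟨n, hn, hxn⟩ := Set.mem_iUnion₂.1 (ht hx)
  have h1 := SimpleFunc.edist_nearestPt_le e (f x) (Finset.le_sup (f := id) hn)
  rw [edist_dist, edist_dist, ENNReal.ofReal_le_ofReal_iff dist_nonneg] at h1
  rw [← dist_eq_norm, dist_comm]
  refine h1.trans ?_
  rw [dist_comm]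
  exact (Metric.mem_ball.1 hxn).le

end VectorIntegral

/-- Serves to rotate several values so that their moduli add up linearly. Norm at most one, rather
than equal to one, allows c = 0 when z = 0. -/
theorem RCLike.exists_norm_le_one_mul_eq_norm {𝕜 : Type*} [RCLike 𝕜] (z : 𝕜) :
    ∃ c : 𝕜, ‖c‖ ≤ 1 ∧ c * z = (‖z‖ : 𝕜) := by
  by_cases hz : z = 0
  · exact ⟨0, by simp, by simp [hz]⟩
  · refine ⟨(‖z‖ : 𝕜)⁻¹ * starRingEnd 𝕜 z, ?_, ?_⟩
    · simp [hz]
    · rw [mul_assoc, RCLike.conj_mul]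
      have : (‖z‖ : 𝕜) ≠ 0 := by simpa using hz
      field_simp

/-! ### Sup norm and evaluations on C₀(E). -/

section ZeroAtInftyNorm

variable {𝕜 : Type*} [RCLike 𝕜] {E : Type*} [TopologicalSpace E]

theorem ZeroAtInftyContinuousMap.norm_apply_le (f : C₀(E, 𝕜)) (x : E) : ‖f x‖ ≤ ‖f‖ := by
  rw [← ZeroAtInftyContinuousMap.norm_toBCF_eq_norm]
  exact f.toBCF.norm_coe_le_norm x

theorem ZeroAtInftyContinuousMap.norm_le {f : C₀(E, 𝕜)} {C : ℝ} (hC : 0 ≤ C) :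
    ‖f‖ ≤ C ↔ ∀ x, ‖f x‖ ≤ C := by
  rw [← ZeroAtInftyContinuousMap.norm_toBCF_eq_norm]
  exact BoundedContinuousFunction.norm_le hC

theorem ZeroAtInftyContinuousMap.integrable [MeasurableSpace E] [BorelSpace E]
    (f : C₀(E, 𝕜)) (ρ : Measure E) [IsFiniteMeasure ρ] :
    Integrable f ρ :=
  Integrable.of_bound (map_continuous f).aestronglyMeasurable ‖f‖
    (.of_forall f.norm_apply_le)

/-- Evaluation at a point as a continuous functional on `C₀(E)`. -/
noncomputable def ZeroAtInftyContinuousMap.evalCLM (𝕜 : Type*) [RCLike 𝕜] {E : Type*}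
    [TopologicalSpace E] (x : E) : StrongDual 𝕜 C₀(E, 𝕜) :=
  LinearMap.mkContinuous
    { toFun := fun f => f x
      map_add' := fun _ _ => rfl
      map_smul' := fun _ _ => rfl } 1 fun f => by simpa using f.norm_apply_le x

@[simp]
theorem ZeroAtInftyContinuousMap.evalCLM_apply (x : E) (f : C₀(E, 𝕜)) :
    ZeroAtInftyContinuousMap.evalCLM 𝕜 x f = f x := rfl

end ZeroAtInftyNorm

/-! ### Radon measures and L¹ approximation by continuous functions. -/

section Radon

variable {𝕜 : Type*} [RCLike 𝕜] {E : Type*} [TopologicalSpace E] [T2Space E]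
  [MeasurableSpace E] [BorelSpace E]

theorem IsRadonMeasure.innerRegular {μ : VectorMeasure E 𝕜} (hμ : IsRadonMeasure μ)
    [IsFiniteMeasure μ.variation] : μ.variation.InnerRegular where
  innerRegular := by
    intro U hU r hr
    obtain ⟨ε, hε, hrε⟩ : ∃ ε : ℝ≥0∞, 0 < ε ∧ r + ε < μ.variation U := by
      obtain ⟨q, hrq, hqU⟩ := exists_between hr
      refine ⟨q - r, tsub_pos_of_lt hrq, ?_⟩
      rwa [add_tsub_cancel_of_le hrq.le]
    obtain ⟨K, hKU, hK, hKε⟩ := hμ U hU ε hε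
    refine ⟨K, hKU, hK, ?_⟩
    have h1 := measure_sdiff_add_inter (μ := μ.variation) U hK.measurableSet
    rw [Set.inter_eq_self_of_subset_right hKU] at h1
    by_contra! h
    have : μ.variation U ≤ r + ε := by
      rw [← h1, add_comm]
      exact add_le_add h hKε
    exact absurd hrε this.not_gt

theorem isRadonMeasure_of_variation_le {μ : VectorMeasure E 𝕜} {ρ : Measure E}
    [IsFiniteMeasure ρ] [ρ.InnerRegularCompactLTTop] (h : μ.variation ≤ ρ) :
    IsRadonMeasure μ := by
  intro A hA ε hε
  obtain ⟨K, hKA, hK, hKε⟩ := hA.exists_isCompact_sdiff_lt (measure_ne_top ρ A) hε.ne'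
  exact ⟨K, hKA, hK, (h _).trans hKε.le⟩

theorem IsRadonMeasure.sub {μ ν : VectorMeasure E 𝕜} (hμ : IsRadonMeasure μ)
    (hν : IsRadonMeasure ν) [IsFiniteMeasure μ.variation] [IsFiniteMeasure ν.variation] :
    IsRadonMeasure (μ - ν) := by
  have := hμ.innerRegular
  have := hν.innerRegular
  exact isRadonMeasure_of_variation_le (VectorMeasure.variation_sub_le (μ := μ) (ν := ν))

instance (μ ν : VectorMeasure E 𝕜) [IsFiniteMeasure μ.variation] [IsFiniteMeasure ν.variation] :
    IsFiniteMeasure (μ - ν).variation :=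
  isFiniteMeasure_of_le _ VectorMeasure.variation_sub_le

variable [LocallyCompactSpace E]

/-- Radial retraction onto the unit ball moves a by at most ‖a‖ - 1 ≤ ‖a‖ - ‖b‖ ≤ ‖a - b‖ when ‖a‖ ≥
1; the triangle inequality gives the factor 2. -/
theorem norm_sub_div_max_le (a b : 𝕜) (hb : ‖b‖ ≤ 1) :
    ‖((max 1 ‖a‖ : ℝ) : 𝕜)⁻¹ * a - b‖ ≤ 2 * ‖a - b‖ := by
  rcases le_total ‖a‖ 1 with ha | ha
  · rw [max_eq_left ha]
    simp only [RCLike.ofReal_one, inv_one, one_mul]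
    linarith [norm_nonneg (a - b)]
  · rw [max_eq_right ha]
    have h0 : (‖a‖ : 𝕜) ≠ 0 := by
      have : ‖a‖ ≠ 0 := by linarith
      exact_mod_cast this
    have h1 : ‖(‖a‖ : 𝕜)⁻¹ * a - a‖ ≤ ‖a - b‖ := by
      have : (‖a‖ : 𝕜)⁻¹ * a - a = ((‖a‖⁻¹ - 1 : ℝ) : 𝕜) * a := by push_cast; ring
      rw [this, norm_mul, RCLike.norm_ofReal]
      have h2 : ‖a‖⁻¹ ≤ 1 := inv_le_one_of_one_le₀ ha
      rw [abs_of_nonpos (by linarith)]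
      have h3 : ‖a‖⁻¹ * ‖a‖ = 1 := inv_mul_cancel₀ (by linarith)
      have h4 := norm_sub_norm_le a b
      nlinarith
    calc _ = ‖((‖a‖ : 𝕜)⁻¹ * a - a) + (a - b)‖ := by congr 1; ring
      _ ≤ _ := norm_add_le _ _
      _ ≤ _ := by linarith

/-- Density of the compactly supported continuous functions in `L¹` of a finite regular measure on a
locally compact Hausdorff space. -/
theorem exists_continuous_hasCompactSupport_integral_sub_le (ρ : Measure E) [IsFiniteMeasure ρ]
    [ρ.Regular] {s : E → 𝕜} (hs : Integrable s ρ) {ε : ℝ} (hε : 0 < ε) :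
    ∃ g : E → 𝕜, Continuous g ∧ HasCompactSupport g ∧ Integrable g ρ ∧
      ∫ x, ‖s x - g x‖ ∂ρ ≤ ε := by
  obtain ⟨g, hgε, hgc, hgs, hgi⟩ := (memLp_one_iff_integrable.2 hs).induction_dense
    ENNReal.one_ne_top
    (fun g : E → 𝕜 => Continuous g ∧ HasCompactSupport g ∧ Integrable g ρ)
    (fun c A hA _ ε hε => by
      obtain ⟨η, hη, H⟩ := exists_eLpNorm_indicator_le (μ := ρ) ENNReal.one_ne_top c hε
      have hη2 : (η : ℝ≥0∞) / 2 ≠ 0 := by simpa using hη.ne'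
      obtain ⟨K, hKA, hK, hKη⟩ := hA.exists_isCompact_sdiff_lt (measure_ne_top ρ A) hη2
      obtain ⟨U, hAU, hU, -, hUη⟩ := hA.exists_isOpen_sdiff_lt (measure_ne_top ρ A) hη2
      obtain ⟨f, hfK, hfU, hfs, hf01⟩ := exists_continuous_one_zero_of_isCompact hK
        hU.isClosed_compl (Set.disjoint_compl_right_iff_subset.2 (hKA.trans hAU))
      have hgs : HasCompactSupport fun x => (f x : 𝕜) * c :=
        (hfs.comp_left (g := fun r : ℝ => (r : 𝕜)) (by simp)).mul_right
      have hgc : Continuous fun x => (f x : 𝕜) * c := by fun_prop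
      refine ⟨fun x => (f x : 𝕜) * c, ?_, hgc, hgs, hgc.integrable_of_hasCompactSupport hgs⟩
      -- The cutoff times c equals the indicator function off U \ K and differs from it by at most
      -- ‖c‖ there. This set has measure at most η, half from U \ A and half from A \ K.
      refine le_trans (eLpNorm_mono (g := (U \ K).indicator fun _ => c) fun x => ?_)
        (H (U \ K) ?_)
      · by_cases hxK : x ∈ K
        · simp [hfK hxK, hKA hxK]
        by_cases hxU : x ∈ U
        · have h0 := (hf01 x).1
          have h1 := (hf01 x).2
          simp only [Pi.sub_apply, Set.indicator_of_mem (show x ∈ U \ K from ⟨hxU, hxK⟩)]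
          by_cases hxA : x ∈ A
          · rw [Set.indicator_of_mem hxA]
            have : (f x : 𝕜) * c - c = ((f x - 1 : ℝ) : 𝕜) * c := by push_cast; ring
            rw [this, norm_mul, RCLike.norm_ofReal]
            refine mul_le_of_le_one_left (norm_nonneg _) ?_
            rw [abs_le]
            constructor <;> linarith
          · rw [Set.indicator_of_notMem hxA, sub_zero, norm_mul, RCLike.norm_ofReal]
            refine mul_le_of_le_one_left (norm_nonneg _) ?_
            rw [abs_le]
            constructor <;> linarith
        · have hxA : x ∉ A := fun h => hxU (hAU h)
          simp [hfU hxU, hxA, hxU]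
      · calc ρ (U \ K) ≤ ρ ((U \ A) ∪ (A \ K)) := by
              refine measure_mono fun x hx => ?_
              by_cases hxA : x ∈ A
              · exact Or.inr ⟨hxA, hx.2⟩
              · exact Or.inl ⟨hx.1, hxA⟩
          _ ≤ ρ (U \ A) + ρ (A \ K) := measure_union_le _ _
          _ ≤ η / 2 + η / 2 := add_le_add hUη.le hKη.le
          _ = η := ENNReal.add_halves _)
    (fun f g hf hg => ⟨hf.1.add hg.1, hf.2.1.add hg.2.1, hf.2.2.add hg.2.2⟩)
    (fun f hf => hf.2.2.1) (ε := ENNReal.ofReal ε) (by simpa using hε)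
  refine ⟨g, hgc, hgs, hgi, ?_⟩
  rw [eLpNorm_one_eq_lintegral_enorm] at hgε
  refine (integral_norm_eq_lintegral_enorm (hs.sub hgi).1).trans_le ?_
  exact ENNReal.toReal_le_of_le_ofReal hε.le hgε

/-- A measurable function bounded by one is an `L¹`-limit of functions in the unit ball of
`C₀(E)`. -/
theorem exists_zeroAtInfty_integral_sub_le (ρ : Measure E) [IsFiniteMeasure ρ] [ρ.Regular]
    {s : E → 𝕜} (hs : AEStronglyMeasurable s ρ) (hs1 : ∀ x, ‖s x‖ ≤ 1) {ε : ℝ} (hε : 0 < ε) :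
    ∃ f : C₀(E, 𝕜), ‖f‖ ≤ 1 ∧ ∫ x, ‖f x - s x‖ ∂ρ ≤ ε := by
  have hsi : Integrable s ρ := Integrable.of_bound hs 1 (.of_forall hs1)
  obtain ⟨g, hgc, hgs, hgi, hgε⟩ :=
    exists_continuous_hasCompactSupport_integral_sub_le ρ hsi (half_pos hε)
  let f : C₀(E, 𝕜) :=
    { toFun := fun x => ((max 1 ‖g x‖ : ℝ) : 𝕜)⁻¹ * g x
      continuous_toFun := by
        refine Continuous.mul (Continuous.inv₀ ?_ fun x => ?_) hgc
        · fun_prop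
        · have : (0 : ℝ) < max 1 ‖g x‖ := by positivity
          exact_mod_cast this.ne'
      zero_at_infty' := by
        refine HasCompactSupport.is_zero_at_infty (f := fun x => _ * g x) ?_
        exact hgs.mul_left }
  have hf : ∀ x, f x = ((max 1 ‖g x‖ : ℝ) : 𝕜)⁻¹ * g x := fun _ => rfl
  refine ⟨f, ?_, ?_⟩
  · rw [ZeroAtInftyContinuousMap.norm_le zero_le_one]
    intro x
    rw [hf, norm_mul, norm_inv, RCLike.norm_ofReal, abs_of_pos (by positivity)]
    exact inv_mul_le_one_of_le₀ (le_max_right _ _) (by positivity)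
  · calc ∫ x, ‖f x - s x‖ ∂ρ ≤ ∫ x, 2 * ‖s x - g x‖ ∂ρ := by
          refine integral_mono ((f.integrable ρ).sub hsi).norm ((hsi.sub hgi).norm.const_mul 2)
            fun x => ?_
          simp only [hf]
          rw [norm_sub_rev (s x)]
          exact norm_sub_div_max_le _ _ (hs1 x)
      _ ≤ ε := by rw [integral_const_mul]; linarith

/-- A finite Radon measure is determined by the integrals of functions in `C₀(E)`. -/
theorem IsRadonMeasure.ext_of_mulIntegral {μ ν : VectorMeasure E 𝕜} (hμ : IsRadonMeasure μ)
    (hν : IsRadonMeasure ν) [IsFiniteMeasure μ.variation] [IsFiniteMeasure ν.variation]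
    (h : ∀ f : C₀(E, 𝕜), mulIntegral μ f = mulIntegral ν f) : μ = ν := by
  have := hμ.innerRegular
  have := hν.innerRegular
  ext A hA
  refine eq_of_forall_dist_le fun ε hε => ?_
  have hs : Measurable (A.indicator fun _ => (1 : 𝕜)) := measurable_const.indicator hA
  have hsb : ∀ x, ‖A.indicator (fun _ => (1 : 𝕜)) x‖ ≤ 1 := fun x => by
    by_cases hx : x ∈ A <;> simp [hx]
  have hsi : ∀ ρ : Measure E, IsFiniteMeasure ρ →
      Integrable (A.indicator fun _ => (1 : 𝕜)) ρ := fun ρ _ =>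
    Integrable.of_bound hs.aestronglyMeasurable 1 (.of_forall hsb)
  -- Approximation in L¹ of the sum makes one f serve both measures.
  obtain ⟨f, -, hf⟩ := exists_zeroAtInfty_integral_sub_le (μ.variation + ν.variation)
    hs.aestronglyMeasurable hsb hε
  have h1 := norm_mulIntegral_sub_le μ (f.integrable _) (hsi μ.variation inferInstance)
  have h2 := norm_mulIntegral_sub_le ν (f.integrable _) (hsi ν.variation inferInstance)
  have hfs : ∀ ρ : Measure E, IsFiniteMeasure ρ →
      Integrable (fun x => ‖f x - A.indicator (fun _ => (1 : 𝕜)) x‖) ρ := fun ρ hρ =>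
    ((f.integrable ρ).sub (hsi ρ hρ)).norm
  rw [integral_add_measure (hfs _ inferInstance) (hfs _ inferInstance)] at hf
  rw [mulIntegral_indicator μ hA, one_mul] at h1
  rw [mulIntegral_indicator ν hA, one_mul] at h2
  rw [dist_eq_norm]
  calc ‖μ A - ν A‖ = ‖(mulIntegral ν f - ν A) - (mulIntegral μ f - μ A)‖ := by
        rw [h f]; congr 1; ring
    _ ≤ _ := norm_sub_le _ _
    _ ≤ ε := by linarith

/-- The total variation norm of a finite Radon measure is at most its norm as a functional on
`C₀(E)`. -/
theorem IsRadonMeasure.tvNorm_le {μ : VectorMeasure E 𝕜} (hμ : IsRadonMeasure μ)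
    [IsFiniteMeasure μ.variation] {C : ℝ}
    (h : ∀ f : C₀(E, 𝕜), ‖f‖ ≤ 1 → ‖mulIntegral μ f‖ ≤ C) : tvNorm μ ≤ C := by
  classical
  have := hμ.innerRegular
  refine le_of_forall_pos_le_add fun ε hε => ?_
  obtain ⟨P, -, hPd, hPm, hP⟩ := VectorMeasure.exists_variation_le_add' μ MeasurableSet.univ
    (ε := ENNReal.ofReal (ε / 2)) (by simpa using hε) (measure_ne_top _ _)
  have hP' : tvNorm μ ≤ ∑ p ∈ P, ‖μ p‖ + ε / 2 := by
    refine ENNReal.toReal_le_of_le_ofReal (by positivity) (hP.trans_eq ?_)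
    rw [ENNReal.ofReal_add (by positivity) (by positivity),
      ENNReal.ofReal_sum_of_nonneg fun _ _ => norm_nonneg _]
    simp
  -- On each piece p of a nearly optimal partition, `s` is a scalar rotating μ p to ‖μ p‖;
  -- disjointness of the pieces keeps ‖s‖ ≤ 1.
  choose c hc1 hc using fun p : Set E => RCLike.exists_norm_le_one_mul_eq_norm (μ p)
  let s : E → 𝕜 := fun x => ∑ p ∈ P, p.indicator (fun _ => c p) x
  have hsm : Measurable s :=
    Finset.measurable_sum _ fun p hp => measurable_const.indicator (hPm p hp)
  have hs1 : ∀ x, ‖s x‖ ≤ 1 := by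
    intro x
    by_cases hx : ∃ p ∈ P, x ∈ p
    · obtain ⟨p, hp, hxp⟩ := hx
      have : s x = c p := by
        refine (Finset.sum_eq_single p (fun q hq hqp => ?_) fun h => absurd hp h).trans ?_
        · refine Set.indicator_of_notMem (fun hxq => ?_) _
          exact Set.disjoint_left.1 (hPd hq hp hqp) hxq hxp
        · simp [hxp]
      rw [this]
      exact hc1 p
    · push Not at hx
      have : s x = 0 := Finset.sum_eq_zero fun p hp => Set.indicator_of_notMem (hx p hp) _
      simp [this]
  have hsi : Integrable s μ.variation :=
    Integrable.of_bound hsm.aestronglyMeasurable 1 (.of_forall hs1)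
  have hint : mulIntegral μ s = ((∑ p ∈ P, ‖μ p‖ : ℝ) : 𝕜) := by
    rw [mulIntegral, VectorMeasure.integral_finsetSum P fun p hp =>
      (integrable_const (c p)).indicator (hPm p hp)]
    push_cast
    refine Finset.sum_congr rfl fun p hp => ?_
    exact (mulIntegral_indicator μ (hPm p hp) (c p)).trans (hc p)
  obtain ⟨f, hf1, hf⟩ := exists_zeroAtInfty_integral_sub_le μ.variation
    hsm.aestronglyMeasurable hs1 (half_pos hε)
  have h1 := (norm_mulIntegral_sub_le μ (f.integrable _) hsi).trans hf
  have h2 : ∑ p ∈ P, ‖μ p‖ = ‖mulIntegral μ s‖ := by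
    rw [hint, RCLike.norm_ofReal, abs_of_nonneg (by positivity)]
  have h3 := norm_sub_norm_le (mulIntegral μ s) (mulIntegral μ f)
  rw [norm_sub_rev] at h3
  linarith [h f hf1]

end Radon

/-! ### Riesz representation of functionals on C₀(E). -/

section Riesz

variable {𝕜 : Type*} [RCLike 𝕜] {E : Type*} [TopologicalSpace E]

/-- The values of a functional `φ` on the functions dominated by `f`, in absolute value. -/
def absValues (φ : StrongDual 𝕜 C₀(E, 𝕜)) (f : E → ℝ) : Set ℝ :=
  {r | ∃ g : C₀(E, 𝕜), (∀ x, ‖g x‖ ≤ f x) ∧ r = ‖φ g‖}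

/-- The absolute value of a functional on `C₀(E)`, evaluated at a nonnegative function. -/
noncomputable def absFunctional (φ : StrongDual 𝕜 C₀(E, 𝕜)) (f : E → ℝ) : ℝ :=
  sSup (absValues φ f)

theorem absFunctional_nonneg (φ : StrongDual 𝕜 C₀(E, 𝕜)) (f : E → ℝ) : 0 ≤ absFunctional φ f := by
  refine Real.sSup_nonneg ?_
  rintro _ ⟨g, -, rfl⟩
  exact norm_nonneg _

theorem norm_le_mul_of_mem_absValues (φ : StrongDual 𝕜 C₀(E, 𝕜)) {f : E → ℝ} {M : ℝ}
    (hM : 0 ≤ M) (hf : ∀ x, f x ≤ M) {r : ℝ} (hr : r ∈ absValues φ f) : r ≤ ‖φ‖ * M := by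
  obtain ⟨g, hg, rfl⟩ := hr
  refine (φ.le_opNorm g).trans (mul_le_mul_of_nonneg_left ?_ (norm_nonneg _))
  exact (ZeroAtInftyContinuousMap.norm_le hM).2 fun x => (hg x).trans (hf x)

theorem absFunctional_le (φ : StrongDual 𝕜 C₀(E, 𝕜)) {f : E → ℝ} {M : ℝ} (hM : 0 ≤ M)
    (hf : ∀ x, f x ≤ M) : absFunctional φ f ≤ ‖φ‖ * M :=
  Real.sSup_le (fun _ hr => norm_le_mul_of_mem_absValues φ hM hf hr) (by positivity)

theorem CompactlySupportedContinuousMap.exists_forall_le (f : C_c(E, ℝ≥0)) :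
    ∃ M : ℝ, 0 ≤ M ∧ ∀ x, (f x : ℝ) ≤ M := by
  obtain ⟨M, hM⟩ := f.continuous.bddAbove_range_of_hasCompactSupport f.hasCompactSupport
  exact ⟨M, M.2, fun x => by exact_mod_cast hM ⟨x, rfl⟩⟩

theorem norm_le_absFunctional (φ : StrongDual 𝕜 C₀(E, 𝕜)) (f : C_c(E, ℝ≥0)) {g : C₀(E, 𝕜)}
    (hg : ∀ x, ‖g x‖ ≤ f x) : ‖φ g‖ ≤ absFunctional φ fun x => f x := by
  obtain ⟨M, hM, hf⟩ := f.exists_forall_le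
  exact le_csSup ⟨_, fun _ hr => norm_le_mul_of_mem_absValues φ hM hf hr⟩ ⟨g, hg, rfl⟩

theorem absFunctional_le_of_forall (φ : StrongDual 𝕜 C₀(E, 𝕜)) {f : E → ℝ} {M : ℝ} (hM : 0 ≤ M)
    (h : ∀ g : C₀(E, 𝕜), (∀ x, ‖g x‖ ≤ f x) → ‖φ g‖ ≤ M) : absFunctional φ f ≤ M := by
  refine Real.sSup_le ?_ hM
  rintro _ ⟨g, hg, rfl⟩
  exact h g hg

/-- The product of `g` with the quotient `f / (h + ε)`. -/
noncomputable def mulQuotient (g : C₀(E, 𝕜)) (f h : C_c(E, ℝ≥0)) (ε : ℝ) (hε : 0 < ε) :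
    C₀(E, 𝕜) where
  toFun x := ((f x / (h x + ε) : ℝ) : 𝕜) * g x
  continuous_toFun := by
    have hf := f.continuous
    have hh := h.continuous
    have hg := map_continuous g
    have h0 : ∀ x, (h x : ℝ) + ε ≠ 0 := fun x => by positivity
    have : Continuous fun x => (f x / (h x + ε) : ℝ) := by fun_prop (disch := exact h0 _)
    fun_prop
  zero_at_infty' := by
    refine HasCompactSupport.is_zero_at_infty (f := fun x => ((f x / (h x + ε) : ℝ) : 𝕜) * g x) ?_
    refine HasCompactSupport.mul_right ?_
    refine f.hasCompactSupport.mono fun x hx => ?_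
    contrapose! hx
    simp only [Function.mem_support, not_not] at hx ⊢
    simp [hx]

theorem mulQuotient_apply (g : C₀(E, 𝕜)) (f h : C_c(E, ℝ≥0)) {ε : ℝ} (hε : 0 < ε) (x : E) :
    mulQuotient g f h ε hε x = ((f x / (h x + ε) : ℝ) : 𝕜) * g x := rfl

theorem norm_mulQuotient_le {g : C₀(E, 𝕜)} {f h : C_c(E, ℝ≥0)} (hg : ∀ x, ‖g x‖ ≤ h x)
    {ε : ℝ} (hε : 0 < ε) (x : E) : ‖mulQuotient g f h ε hε x‖ ≤ f x := by
  have h0 : (0 : ℝ) < h x + ε := by positivity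
  rw [mulQuotient_apply, norm_mul, RCLike.norm_ofReal, abs_of_nonneg (by positivity),
    div_mul_eq_mul_div, div_le_iff₀ h0]
  exact mul_le_mul_of_nonneg_left (by linarith [hg x]) (by positivity)

/-- For ≤, a function g dominated by f₁ + f₂ splits, up to a small error, in the proportions f₁ :
f₂. For ≥, unimodular rotations of g₁ and g₂ make φ g₁ and φ g₂ nonnegative, so that their moduli
add. -/
theorem absFunctional_add (φ : StrongDual 𝕜 C₀(E, 𝕜)) (f₁ f₂ : C_c(E, ℝ≥0)) :
    absFunctional φ (fun x => (f₁ + f₂) x) =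
      absFunctional φ (fun x => f₁ x) + absFunctional φ (fun x => f₂ x) := by
  apply le_antisymm
  · refine absFunctional_le_of_forall φ
      (add_nonneg (absFunctional_nonneg _ _) (absFunctional_nonneg _ _)) fun g hg => ?_
    refine le_of_forall_pos_le_add fun δ hδ => ?_
    -- The remainder of the splitting is εg / (f₁ + f₂ + ε), of norm at most ε, so φ maps it to at
    -- most δ. The summand 1 covers φ = 0.
    set ε : ℝ := δ / (‖φ‖ + 1) with hεdef
    have hε : 0 < ε := by positivity
    set g₁ := mulQuotient g f₁ (f₁ + f₂) ε hε
    set g₂ := mulQuotient g f₂ (f₁ + f₂) ε hε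
    have hrest : ‖g - g₁ - g₂‖ ≤ ε := by
      rw [ZeroAtInftyContinuousMap.norm_le hε.le]
      intro x
      have h0 : (0 : ℝ) < (f₁ + f₂) x + ε := by positivity
      have : (g - g₁ - g₂) x = ((ε / ((f₁ + f₂) x + ε) : ℝ) : 𝕜) * g x := by
        simp only [ZeroAtInftyContinuousMap.sub_apply, g₁, g₂, mulQuotient_apply]
        have h1 : (1 : ℝ) - f₁ x / ((f₁ + f₂) x + ε) - f₂ x / ((f₁ + f₂) x + ε)
            = ε / ((f₁ + f₂) x + ε) := by
          field_simp
          simp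
          ring
        rw [← h1]
        push_cast
        ring
      rw [this, norm_mul, RCLike.norm_ofReal, abs_of_nonneg (by positivity),
        div_mul_eq_mul_div, div_le_iff₀ h0]
      exact mul_le_mul_of_nonneg_left (by linarith [hg x]) hε.le
    have h1 := norm_le_absFunctional φ f₁ (norm_mulQuotient_le hg hε)
    have h2 := norm_le_absFunctional φ f₂ (norm_mulQuotient_le hg hε)
    have h3 : ‖φ (g - g₁ - g₂)‖ ≤ δ := by
      refine (φ.le_opNorm _).trans ((mul_le_mul_of_nonneg_left hrest (norm_nonneg _)).trans ?_)
      rw [hεdef, mul_div_assoc', div_le_iff₀ (by positivity)]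
      nlinarith [norm_nonneg φ]
    have h4 : φ g = φ g₁ + φ g₂ + φ (g - g₁ - g₂) := by
      simp only [map_sub]; ring
    rw [h4]
    refine norm_add₃_le.trans ?_
    linarith
  · have key : ∀ g₁ g₂ : C₀(E, 𝕜), (∀ x, ‖g₁ x‖ ≤ f₁ x) → (∀ x, ‖g₂ x‖ ≤ f₂ x) →
        ‖φ g₁‖ + ‖φ g₂‖ ≤ absFunctional φ (fun x => (f₁ + f₂) x) := by
      intro g₁ g₂ h₁ h₂
      obtain ⟨c₁, hc₁, e₁⟩ := RCLike.exists_norm_le_one_mul_eq_norm (φ g₁)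
      obtain ⟨c₂, hc₂, e₂⟩ := RCLike.exists_norm_le_one_mul_eq_norm (φ g₂)
      have h3 := norm_le_absFunctional φ (f₁ + f₂) (g := c₁ • g₁ + c₂ • g₂) fun x => by
        simp only [ZeroAtInftyContinuousMap.add_apply, ZeroAtInftyContinuousMap.smul_apply]
        refine (norm_add_le _ _).trans ?_
        rw [norm_smul, norm_smul]
        push_cast [CompactlySupportedContinuousMap.add_apply]
        exact add_le_add ((mul_le_of_le_one_left (norm_nonneg _) hc₁).trans (h₁ x))
          ((mul_le_of_le_one_left (norm_nonneg _) hc₂).trans (h₂ x))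
      rw [map_add, map_smul, map_smul, smul_eq_mul, smul_eq_mul, e₁, e₂, ← RCLike.ofReal_add,
        RCLike.norm_ofReal, abs_of_nonneg (by positivity)] at h3
      exact h3
    have h0 : ∀ x, ‖(0 : C₀(E, 𝕜)) x‖ ≤ f₁ x := by simp
    have h0' : ∀ x, ‖(0 : C₀(E, 𝕜)) x‖ ≤ f₂ x := by simp
    -- The suprema over g₁ and g₂ are taken one after the other; the pairs with one entry zero
    -- supply the required nonnegativity of the bounds.
    rw [← le_sub_iff_add_le]
    refine absFunctional_le_of_forall φ ?_ fun g₁ h₁ => ?_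
    · rw [sub_nonneg]
      refine absFunctional_le_of_forall φ (absFunctional_nonneg _ _) fun g₂ h₂ => ?_
      have := key 0 g₂ h0 h₂
      simpa using this
    · rw [le_sub_comm]
      refine absFunctional_le_of_forall φ ?_ fun g₂ h₂ => ?_
      · have := key g₁ 0 h₁ h0'
        simp only [map_zero, norm_zero, add_zero] at this
        linarith
      · have := key g₁ g₂ h₁ h₂
        linarith

/-- The inequality ≤ for all scalars is enough: for c ≠ 0, applying it to c⁻¹ and c • f gives the
reverse one. -/
theorem absFunctional_smul (φ : StrongDual 𝕜 C₀(E, 𝕜)) (c : ℝ≥0) (f : C_c(E, ℝ≥0)) :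
    absFunctional φ (fun x => (c • f) x) = c * absFunctional φ (fun x => f x) := by
  have h1 : ∀ (c : ℝ≥0) (f : C_c(E, ℝ≥0)),
      absFunctional φ (fun x => (c • f) x) ≤ c * absFunctional φ (fun x => f x) := by
    intro c f
    refine absFunctional_le_of_forall φ (mul_nonneg c.2 (absFunctional_nonneg _ _)) fun g hg => ?_
    rcases eq_or_ne c 0 with rfl | hc
    · have : g = 0 := by
        ext x
        have := hg x
        simp at this
        simpa using this
      simp [this]
    · have hc' : (0 : ℝ) < c := by positivity
      have := norm_le_absFunctional φ f (g := ((c : ℝ)⁻¹ : 𝕜) • g) fun x => by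
        simp only [ZeroAtInftyContinuousMap.smul_apply]
        rw [norm_smul, norm_inv, RCLike.norm_ofReal, abs_of_pos hc', inv_mul_le_iff₀ hc']
        simpa using hg x
      rw [map_smul, norm_smul, norm_inv, RCLike.norm_ofReal, abs_of_pos hc',
        inv_mul_le_iff₀ hc'] at this
      exact this
  refine le_antisymm (h1 c f) ?_
  rcases eq_or_ne c 0 with rfl | hc
  · simpa using absFunctional_nonneg φ _
  · have hc' : (0 : ℝ) < c := by positivity
    have := h1 c⁻¹ (c • f)
    rw [smul_smul, inv_mul_cancel₀ hc, one_smul, NNReal.coe_inv, le_inv_mul_iff₀ hc'] at this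
    exact this

/-- The absolute value of a functional as a positive linear functional. -/
noncomputable def absLinear (φ : StrongDual 𝕜 C₀(E, 𝕜)) : C_c(E, ℝ≥0) →ₗ[ℝ≥0] ℝ≥0 where
  toFun f := ⟨absFunctional φ fun x => f x, absFunctional_nonneg _ _⟩
  map_add' f g := NNReal.eq (absFunctional_add φ f g)
  map_smul' c f := NNReal.eq (absFunctional_smul φ c f)

variable [T2Space E] [LocallyCompactSpace E] [MeasurableSpace E] [BorelSpace E]

theorem rieszMeasure_absLinear_univ_le (φ : StrongDual 𝕜 C₀(E, 𝕜)) :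
    NNRealRMK.rieszMeasure (absLinear φ) Set.univ ≤ ENNReal.ofReal ‖φ‖ := by
  rw [isOpen_univ.measure_eq_iSup_isCompact]
  refine iSup₂_le fun K _ => iSup_le fun hK => ?_
  obtain ⟨f, hfK, -, hfs, hf01⟩ := exists_continuous_one_zero_of_isCompact hK isClosed_empty
    (Set.disjoint_empty K)
  let F : C_c(E, ℝ≥0) := ⟨⟨fun x => (f x).toNNReal, by fun_prop⟩,
    hfs.comp_left (g := Real.toNNReal) (by simp)⟩
  have hF : ∀ x, F x = (f x).toNNReal := fun _ => rfl
  have hF1 : ∀ x, (F x : ℝ) ≤ 1 := fun x => by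
    rw [hF, Real.coe_toNNReal _ (hf01 x).1]; exact (hf01 x).2
  calc NNRealRMK.rieszMeasure (absLinear φ) K
      = ∫⁻ x, K.indicator 1 x ∂NNRealRMK.rieszMeasure (absLinear φ) := by
        rw [lintegral_indicator_one hK.measurableSet]
    _ ≤ ∫⁻ x, F x ∂NNRealRMK.rieszMeasure (absLinear φ) := by
        refine lintegral_mono fun x => ?_
        by_cases hx : x ∈ K
        · simp [hx, hF, hfK hx]
        · simp [hx]
    _ = absLinear φ F := NNRealRMK.lintegral_rieszMeasure _ _
    _ ≤ ENNReal.ofReal ‖φ‖ := by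
        rw [← ENNReal.ofReal_coe_nnreal]
        refine ENNReal.ofReal_le_ofReal ?_
        exact (absFunctional_le φ zero_le_one hF1).trans_eq (mul_one _)

/-- For compactly supported g, ‖φ g‖ is at most |φ|(|g|), which is ∫ |g| dρ for the Riesz–Markov
measure ρ of |φ|. A general g is multiplied by a cutoff equal to 1 on a compact set outside which
|g| < ε. -/
theorem exists_measure_norm_le_integral (φ : StrongDual 𝕜 C₀(E, 𝕜)) :
    ∃ ρ : Measure E, IsFiniteMeasure ρ ∧ ρ.Regular ∧ ρ Set.univ ≤ ENNReal.ofReal ‖φ‖ ∧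
      ∀ f : C₀(E, 𝕜), ‖φ f‖ ≤ ∫ x, ‖f x‖ ∂ρ := by
  have hfin : IsFiniteMeasure (NNRealRMK.rieszMeasure (absLinear φ)) :=
    ⟨(rieszMeasure_absLinear_univ_le φ).trans_lt ENNReal.ofReal_lt_top⟩
  refine ⟨NNRealRMK.rieszMeasure (absLinear φ), hfin, inferInstance,
    rieszMeasure_absLinear_univ_le φ, fun g => ?_⟩
  refine le_of_forall_pos_le_add fun δ hδ => ?_
  set ε : ℝ := δ / (‖φ‖ + 1) with hεdef
  have hε : 0 < ε := by positivity
  have hg0 : ∀ᶠ x in cocompact E, ‖g x‖ < ε := by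
    have := (zero_at_infty g).norm
    rw [norm_zero] at this
    exact this.eventually (gt_mem_nhds hε)
  obtain ⟨K, hK, hKg⟩ := mem_cocompact.1 hg0
  obtain ⟨χ, hχK, -, hχs, hχ01⟩ := exists_continuous_one_zero_of_isCompact hK isClosed_empty
    (Set.disjoint_empty K)
  have hsupp : HasCompactSupport fun x => (χ x : 𝕜) * g x :=
    (hχs.comp_left (g := fun r : ℝ => (r : 𝕜)) (by simp)).mul_right
  have hcont : Continuous fun x => (χ x : 𝕜) * g x := by
    have := map_continuous g
    fun_prop
  let g' : C₀(E, 𝕜) := ⟨⟨fun x => (χ x : 𝕜) * g x, hcont⟩, hsupp.is_zero_at_infty⟩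
  have hg' : ∀ x, g' x = (χ x : 𝕜) * g x := fun _ => rfl
  let F : C_c(E, ℝ≥0) := ⟨⟨fun x => ‖g' x‖₊, (map_continuous g').nnnorm⟩,
    hsupp.comp_left (g := fun z => ‖z‖₊) (by simp)⟩
  have hF : ∀ x, (F x : ℝ) = ‖g' x‖ := fun _ => rfl
  have h1 : ‖φ g'‖ ≤ ∫ x, ‖g x‖ ∂NNRealRMK.rieszMeasure (absLinear φ) := by
    refine (norm_le_absFunctional φ F fun x => (hF x).ge).trans ?_
    have h2 := NNRealRMK.integral_rieszMeasure (absLinear φ) F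
    have h3 : ((absLinear φ F : ℝ≥0) : ℝ) = absFunctional φ fun x => F x := rfl
    rw [← h3, ← h2]
    refine integral_mono ?_ (g.integrable _).norm fun x => ?_
    · simp only [hF]
      exact (g'.integrable _).norm
    · simp only [hF, hg', norm_mul, RCLike.norm_ofReal, abs_of_nonneg (hχ01 x).1]
      exact mul_le_of_le_one_left (norm_nonneg _) (hχ01 x).2
  have h2 : ‖g - g'‖ ≤ ε := by
    rw [ZeroAtInftyContinuousMap.norm_le hε.le]
    intro x
    have h3 : (g - g') x = ((1 - χ x : ℝ) : 𝕜) * g x := by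
      rw [ZeroAtInftyContinuousMap.sub_apply, hg']; push_cast; ring
    have h4 := (hχ01 x).1
    have h5 := (hχ01 x).2
    rw [h3, norm_mul, RCLike.norm_ofReal, abs_of_nonneg (by linarith)]
    by_cases hx : x ∈ K
    · simp [hχK hx, hε.le]
    · have h6 : ‖g x‖ < ε := hKg hx
      nlinarith [norm_nonneg (g x)]
  have h3 : ‖φ (g - g')‖ ≤ δ := by
    refine (φ.le_opNorm _).trans ((mul_le_mul_of_nonneg_left h2 (norm_nonneg _)).trans ?_)
    rw [hεdef, mul_div_assoc', div_le_iff₀ (by positivity)]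
    nlinarith [norm_nonneg φ]
  have h4 : φ g = φ g' + φ (g - g') := by rw [map_sub]; ring
  rw [h4]
  exact (norm_add_le _ _).trans (add_le_add h1 h3)

/-- **Riesz representation theorem**: every bounded functional on `C₀(E)` is the integral against a
signed or complex Radon measure. -/
theorem exists_isRadonMeasure_eq_mulIntegral (φ : StrongDual 𝕜 C₀(E, 𝕜)) :
    ∃ μ : VectorMeasure E 𝕜, IsRadonMeasure μ ∧ μ.variation Set.univ ≤ ENNReal.ofReal ‖φ‖ ∧
      ∀ f : C₀(E, 𝕜), φ f = mulIntegral μ f := by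
  obtain ⟨ρ, hρ, hreg, hρφ, hφ⟩ := exists_measure_norm_le_integral φ
  have hmem : ∀ f : C₀(E, 𝕜), MemLp f 1 ρ := fun f => memLp_one_iff_integrable.2 (f.integrable ρ)
  let ι : C₀(E, 𝕜) →ₗ[𝕜] Lp 𝕜 1 ρ :=
    { toFun := fun f => (hmem f).toLp f
      map_add' := fun f g => (hmem f).toLp_add (hmem g)
      map_smul' := fun c f => (hmem f).toLp_const_smul c }
  have hι : ∀ f, ‖φ f‖ ≤ ‖ι f‖ := fun f => by
    refine (hφ f).trans_eq ?_
    rw [L1.norm_eq_integral_norm]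
    refine integral_congr_ae ?_
    filter_upwards [(hmem f).coeFn_toLp] with x hx
    exact congrArg norm hx.symm
  -- φ descends to the range of ι: by `hι` it vanishes on the kernel of ι, so the choice of the
  -- linear section r is immaterial.
  obtain ⟨r, hr⟩ := ι.rangeRestrict.exists_rightInverse_of_surjective ι.range_rangeRestrict
  have hr' : ∀ v : LinearMap.range ι, ι (r v) = v := fun v =>
    congrArg Subtype.val (LinearMap.congr_fun hr v)
  let ψ : StrongDual 𝕜 (LinearMap.range ι) :=
    (φ.toLinearMap.comp r).mkContinuous 1 fun v => by
      rw [one_mul]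
      refine (hι (r v)).trans_eq ?_
      rw [hr' v]
      rfl
  have hψ1 : ‖ψ‖ ≤ 1 := LinearMap.mkContinuous_norm_le _ zero_le_one _
  have hψ : ∀ f, ψ ⟨ι f, f, rfl⟩ = φ f := fun f => by
    change φ (r ⟨ι f, f, rfl⟩) = φ f
    rw [← sub_eq_zero, ← map_sub, ← norm_le_zero_iff]
    refine (hι _).trans_eq ?_
    rw [map_sub, hr', sub_self, norm_zero]
  obtain ⟨Ψ, hΨ, hΨn⟩ := exists_extension_norm_eq _ ψ
  obtain ⟨μ, hμρ, hμ⟩ := exists_vectorMeasure_eq_of_strongDual_L1 ρ Ψ (hΨn.trans_le hψ1)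
  refine ⟨μ, isRadonMeasure_of_variation_le hμρ, (hμρ _).trans hρφ, fun f => ?_⟩
  rw [hμ f (hmem f), ← hψ f]
  exact (hΨ ⟨ι f, f, rfl⟩).symm

end Riesz

/-! ### The total variation norm and bounds for kernels. -/

section TotalVariation

variable {𝕜 : Type*} [RCLike 𝕜] {X : Type*} [MeasurableSpace X]

theorem tvNorm_nonneg (μ : VectorMeasure X 𝕜) : 0 ≤ tvNorm μ := ENNReal.toReal_nonneg

theorem tvNorm_sub_comm (μ ν : VectorMeasure X 𝕜) : tvNorm (μ - ν) = tvNorm (ν - μ) := by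
  rw [tvNorm, ← VectorMeasure.variation_neg, neg_sub, tvNorm]

theorem tvNorm_le_add_tvNorm_sub (μ ν : VectorMeasure X 𝕜) [IsFiniteMeasure μ.variation]
    [IsFiniteMeasure ν.variation] : tvNorm μ ≤ tvNorm ν + tvNorm (μ - ν) := by
  have : IsFiniteMeasure (μ - ν).variation :=
    isFiniteMeasure_of_le _ VectorMeasure.variation_sub_le
  have h : μ.variation ≤ ν.variation + (μ - ν).variation := by
    have := VectorMeasure.variation_add_le (μ := ν) (ν := μ - ν)
    rwa [add_sub_cancel] at this
  rw [tvNorm, tvNorm, tvNorm, ← ENNReal.toReal_add (measure_ne_top _ _) (measure_ne_top _ _)]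
  refine ENNReal.toReal_mono (by finiteness) ?_
  exact h Set.univ

theorem abs_tvNorm_sub_le (μ ν : VectorMeasure X 𝕜) [IsFiniteMeasure μ.variation]
    [IsFiniteMeasure ν.variation] : |tvNorm μ - tvNorm ν| ≤ tvNorm (μ - ν) := by
  rw [abs_le]
  have h1 := tvNorm_le_add_tvNorm_sub μ ν
  have h2 := tvNorm_le_add_tvNorm_sub ν μ
  rw [tvNorm_sub_comm] at h2
  constructor <;> linarith

end TotalVariation

namespace BoundedKernel

variable {𝕜 : Type*} [RCLike 𝕜] {E : Type*} [TopologicalSpace E] [MeasurableSpace E]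

instance (k : BoundedKernel 𝕜 E) (x : E) : IsFiniteMeasure (k.toMeasure x).variation :=
  ⟨(le_iSup (fun x => (k.toMeasure x).variation Set.univ) x).trans_lt k.bounded⟩

/-- The supremum of the total variation norms of a kernel. -/
noncomputable def bound (k : BoundedKernel 𝕜 E) : ℝ :=
  (⨆ x, (k.toMeasure x).variation Set.univ).toReal

theorem bound_nonneg (k : BoundedKernel 𝕜 E) : 0 ≤ k.bound := ENNReal.toReal_nonneg

theorem tvNorm_le_bound (k : BoundedKernel 𝕜 E) (x : E) : tvNorm (k.toMeasure x) ≤ k.bound :=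
  ENNReal.toReal_mono k.bounded.ne (le_iSup (fun x => (k.toMeasure x).variation Set.univ) x)

theorem IsTVContinuous.continuous_tvNorm {k : BoundedKernel 𝕜 E}
    (hk : k.IsTVContinuous) : Continuous fun x => tvNorm (k.toMeasure x) := by
  rw [continuous_iff_continuousAt]
  intro x
  rw [ContinuousAt, tendsto_iff_dist_tendsto_zero]
  exact squeeze_zero (fun _ => dist_nonneg)
    (fun y => abs_tvNorm_sub_le (k.toMeasure y) (k.toMeasure x)) (hk x)

end BoundedKernel

/-! ### Weak and norm compactness of operators. -/

section WeakTopology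

variable {𝕜 : Type*} [RCLike 𝕜] {E : Type*} [TopologicalSpace E]

/-- Point evaluations are weakly continuous. Hence a weakly compact set is compact, and so closed,
among all functions E → 𝕜 with the product topology. -/
theorem continuous_coe_toWeakSpace_symm :
    Continuous fun (w : WeakSpace 𝕜 C₀(E, 𝕜)) (x : E) => (toWeakSpace 𝕜 C₀(E, 𝕜)).symm w x :=
  continuous_pi fun x => WeakBilin.eval_continuous (topDualPairing 𝕜 C₀(E, 𝕜)).flip
    (ZeroAtInftyContinuousMap.evalCLM 𝕜 x)

theorem IsCompactOperator.isWeaklyCompactOperator {X Y : Type*} [NormedAddCommGroup X]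
    [NormedSpace 𝕜 X] [NormedAddCommGroup Y] [NormedSpace 𝕜 Y] {T : X →L[𝕜] Y}
    (hT : IsCompactOperator T) : IsWeaklyCompactOperator T := by
  intro B hB
  have : T2Space (WeakSpace 𝕜 Y) :=
    (NormedSpace.isEmbedding_inclusionInDoubleDualWeak 𝕜 Y).t2Space
  have h1 : IsCompact (closure (T '' B)) :=
    IsCompactOperator.isCompact_closure_image_of_bounded (f := T.toLinearMap) hT hB
  exact (h1.image (toWeakSpaceCLM 𝕜 Y).continuous).closure_of_subset
    (Set.image_mono subset_closure)

/-- The image of the unit ball under a compact operator is equicontinuous and vanishes uniformly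
along any filter on which all functions in `C₀(E)` converge. -/
theorem IsCompactOperator.eventually_norm_sub_le {T : C₀(E, 𝕜) →L[𝕜] C₀(E, 𝕜)}
    (hT : IsCompactOperator T) {l : Filter E} (L : StrongDual 𝕜 C₀(E, 𝕜)) (hL1 : ‖L‖ ≤ 1)
    (hL : ∀ f : C₀(E, 𝕜), Tendsto f l (𝓝 (L f))) {ε : ℝ} (hε : 0 < ε) :
    ∀ᶠ y in l, ∀ f : C₀(E, 𝕜), ‖f‖ ≤ 1 → ‖T f y - L (T f)‖ ≤ ε := by
  have hcpt : IsCompact (closure (T '' Metric.closedBall 0 1)) :=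
    IsCompactOperator.isCompact_closure_image_closedBall (f := T.toLinearMap) hT 1
  obtain ⟨t, ht, htc⟩ := Metric.totallyBounded_iff.1
    (hcpt.totallyBounded.subset subset_closure) (ε / 3) (by positivity)
  have hev : ∀ᶠ y in l, ∀ g ∈ t, ‖g y - L g‖ ≤ ε / 3 := by
    rw [Filter.eventually_all_finite ht]
    intro g _
    have := (hL g).eventually (Metric.closedBall_mem_nhds _ (by positivity : 0 < ε / 3))
    simpa [dist_eq_norm] using this
  filter_upwards [hev] with y hy f hf
  have hfm : T f ∈ T '' Metric.closedBall 0 1 := Set.mem_image_of_mem _ (by simpa using hf)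
  obtain ⟨g, hg, hfg⟩ := Set.mem_iUnion₂.1 (htc hfm)
  rw [Metric.mem_ball, dist_eq_norm] at hfg
  have h1 : ‖(T f - g) y‖ ≤ ε / 3 := ((T f - g).norm_apply_le y).trans hfg.le
  have h2 : ‖L (T f - g)‖ ≤ ε / 3 :=
    (L.le_of_opNorm_le hL1 _).trans (by rw [one_mul]; exact hfg.le)
  have h3 : T f y - L (T f) = (T f - g) y + (g y - L g) - L (T f - g) := by
    rw [map_sub, ZeroAtInftyContinuousMap.sub_apply]; ring
  rw [h3]
  refine (norm_sub_le _ _).trans ((add_le_add (norm_add_le _ _) le_rfl).trans ?_)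
  linarith [hy g hg]

theorem mulIntegral_sub_vectorMeasure [MeasurableSpace E] [BorelSpace E]
    (μ ν : VectorMeasure E 𝕜) [IsFiniteMeasure μ.variation]
    [IsFiniteMeasure ν.variation] (f : C₀(E, 𝕜)) :
    mulIntegral (μ - ν) f = mulIntegral μ f - mulIntegral ν f :=
  VectorMeasure.integral_sub_vectorMeasure (f.integrable _) (f.integrable _)

/-- An operator whose kernel is continuous in total variation and vanishes at infinity is
compact. -/
theorem IsKernelOf.isCompactOperator [MeasurableSpace E] [BorelSpace E]
    {T : C₀(E, 𝕜) →L[𝕜] C₀(E, 𝕜)} {k : BoundedKernel 𝕜 E}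
    (hk : IsKernelOf k T) (hcont : k.IsTVContinuous)
    (h0 : MemC0 fun x => tvNorm (k.toMeasure x)) : IsCompactOperator T := by
  refine (isCompactOperator_iff_isCompact_closure_image_closedBall T.toLinearMap one_pos).2 ?_
  refine TotallyBounded.isCompact_of_isClosed ?_ isClosed_closure
  refine TotallyBounded.closure ?_
  refine Metric.totallyBounded_of_finite_discretization fun ε hε => ?_
  have hδ : 0 < ε / 6 := by positivity
  obtain ⟨F, hF⟩ := h0
  have hF' : ∀ x, F x = tvNorm (k.toMeasure x) := fun x => congrFun hF x
  have hout : ∀ᶠ x in cocompact E, tvNorm (k.toMeasure x) < ε / 6 := by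
    have := (zero_at_infty F).eventually (gt_mem_nhds hδ)
    simpa only [hF'] using this
  obtain ⟨K, hK, hKout⟩ := mem_cocompact.1 hout
  obtain ⟨t, -, htK⟩ := hK.elim_nhds_subcover
    (fun x => {y | tvNorm (k.toMeasure y - k.toMeasure x) < ε / 6})
    fun x _ => (hcont x).eventually (gt_mem_nhds hδ)
  -- On K, functions in the image of the ball are determined up to ε/6 by their values on the finite
  -- set t. These values lie in a finite-dimensional ball, and a point of its finite net u serves as
  -- a code for the function.
  have hcpt : IsCompact (Metric.closedBall (0 : t → 𝕜) ‖T‖) := isCompact_closedBall _ _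
  obtain ⟨u, hu, hucov⟩ := Metric.totallyBounded_iff.1 hcpt.totallyBounded (ε / 6) hδ
  have hnear : ∀ z : T.toLinearMap '' Metric.closedBall 0 1, ∃ v : u,
      ∀ i : t, ‖(z : C₀(E, 𝕜)) i - (v : t → 𝕜) i‖ < ε / 6 := by
    rintro ⟨_, f, hf, rfl⟩
    have hmem : (fun i : t => T f i) ∈ Metric.closedBall (0 : t → 𝕜) ‖T‖ := by
      rw [mem_closedBall_zero_iff, pi_norm_le_iff_of_nonneg (norm_nonneg T)]
      intro i
      refine ((T f).norm_apply_le i).trans (T.unit_le_opNorm f ?_)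
      simpa using hf
    obtain ⟨v, hv, hfv⟩ := Set.mem_iUnion₂.1 (hucov hmem)
    refine ⟨⟨v, hv⟩, fun i => ?_⟩
    rw [Metric.mem_ball, dist_eq_norm] at hfv
    exact (norm_le_pi_norm ((fun i : t => T f i) - v) i).trans_lt hfv
  choose V hV using hnear
  have hufin : Fintype u := hu.fintype
  obtain ⟨n, ⟨e⟩⟩ := Finite.exists_equiv_fin u
  refine ⟨ULift (Fin n), inferInstance, fun z => ULift.up (e (V z)), ?_⟩
  intro z₁ z₂ h12
  have hVeq : V z₁ = V z₂ := e.injective (ULift.up_injective h12)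
  have hosc : ∀ z : T.toLinearMap '' Metric.closedBall 0 1, ∀ x, ∀ i ∈ t,
      tvNorm (k.toMeasure x - k.toMeasure i) < ε / 6 →
      ‖(z : C₀(E, 𝕜)) x - (z : C₀(E, 𝕜)) i‖ ≤ ε / 6 := by
    rintro ⟨_, f, hf, rfl⟩ x i _ hxi
    change ‖T f x - T f i‖ ≤ ε / 6
    rw [hk f x, hk f i]
    refine (congrArg norm (mulIntegral_sub_vectorMeasure _ _ f)).symm.trans_le ?_
    refine (norm_mulIntegral_le_of_bound _ (C := 1) fun y => ?_).trans ?_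
    · exact (f.norm_apply_le y).trans (by simpa using hf)
    · rw [one_mul]; exact hxi.le
  have hsmall : ∀ z : T.toLinearMap '' Metric.closedBall 0 1, ∀ x,
      tvNorm (k.toMeasure x) < ε / 6 → ‖(z : C₀(E, 𝕜)) x‖ ≤ ε / 6 := by
    rintro ⟨_, f, hf, rfl⟩ x hx
    change ‖T f x‖ ≤ ε / 6
    rw [hk f x]
    refine (norm_mulIntegral_le_of_bound _ (C := 1) fun y => ?_).trans ?_
    · exact (f.norm_apply_le y).trans (by simpa using hf)
    · rw [one_mul]; exact hx.le
  rw [dist_eq_norm]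
  -- The estimates give 4ε/6 on K and 2ε/6 off K; any bound below ε makes the supremum strictly
  -- smaller than ε.
  refine lt_of_le_of_lt (b := 5 * ε / 6) ?_ (by linarith)
  rw [ZeroAtInftyContinuousMap.norm_le (by positivity)]
  intro x
  rw [ZeroAtInftyContinuousMap.sub_apply]
  by_cases hx : x ∈ K
  · obtain ⟨i, hi, hxi⟩ := Set.mem_iUnion₂.1 (htK hx)
    have h1 := hosc z₁ x i hi hxi
    have h2 := hosc z₂ x i hi hxi
    have h3 := (hV z₁ ⟨i, hi⟩).le
    have h4 := (hV z₂ ⟨i, hi⟩).le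
    rw [← hVeq] at h4
    set a := (V z₁ : t → 𝕜) ⟨i, hi⟩
    calc _ = ‖((z₁ : C₀(E, 𝕜)) x - (z₁ : C₀(E, 𝕜)) i) + ((z₁ : C₀(E, 𝕜)) i - a)
          - ((z₂ : C₀(E, 𝕜)) i - a) - ((z₂ : C₀(E, 𝕜)) x - (z₂ : C₀(E, 𝕜)) i)‖ := by
          congr 1; ring
      _ ≤ _ := (norm_sub_le _ _).trans (add_le_add ((norm_sub_le _ _).trans
          (add_le_add (norm_add_le _ _) le_rfl)) le_rfl)
      _ ≤ ε / 6 + ε / 6 + ε / 6 + ε / 6 := by gcongr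
      _ ≤ 5 * ε / 6 := by linarith
  · have hx' : tvNorm (k.toMeasure x) < ε / 6 := hKout hx
    refine (norm_sub_le _ _).trans ?_
    linarith [hsmall z₁ x hx', hsmall z₂ x hx']

end WeakTopology

/-! ### Uniqueness, existence and continuity of the kernel. -/

section Kernels

variable {𝕜 : Type*} [RCLike 𝕜] {E : Type*} [TopologicalSpace E] [T2Space E]
  [LocallyCompactSpace E] [MeasurableSpace E] [BorelSpace E]

/-- The kernel associated with an operator is unique. -/
theorem IsKernelOf.unique {T : C₀(E, 𝕜) →L[𝕜] C₀(E, 𝕜)} {k₁ k₂ : BoundedKernel 𝕜 E}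
    (h₁ : IsKernelOf k₁ T) (h₂ : IsKernelOf k₂ T) : k₁ = k₂ := by
  ext x : 2
  exact (k₁.radon x).ext_of_mulIntegral (k₂.radon x) fun f => (h₁ f x).symm.trans (h₂ f x)

/-- Every operator on `C₀(E)` is represented by a bounded family of Radon measures. -/
theorem exists_family_eq_mulIntegral (T : C₀(E, 𝕜) →L[𝕜] C₀(E, 𝕜)) :
    ∃ κ : E → VectorMeasure E 𝕜, (∀ x, IsRadonMeasure (κ x)) ∧
      (∀ x, (κ x).variation Set.univ ≤ ENNReal.ofReal ‖T‖) ∧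
      ∀ f x, T f x = mulIntegral (κ x) f := by
  choose κ hκ hκT hκf using fun x => exists_isRadonMeasure_eq_mulIntegral
    ((ZeroAtInftyContinuousMap.evalCLM 𝕜 x).comp T)
  refine ⟨κ, hκ, fun x => (hκT x).trans (ENNReal.ofReal_le_ofReal ?_), fun f x => hκf x f⟩
  refine ContinuousLinearMap.opNorm_le_bound _ (norm_nonneg T) fun f => ?_
  exact ((T f).norm_apply_le x).trans (T.le_opNorm f)

/-- The measures representing a weakly compact operator depend on the point like functions in
`C₀(E)`. -/
theorem IsWeaklyCompactOperator.memC0 {T : C₀(E, 𝕜) →L[𝕜] C₀(E, 𝕜)}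
    (hT : IsWeaklyCompactOperator T) {κ : E → VectorMeasure E 𝕜} (hκ : ∀ x, IsRadonMeasure (κ x))
    [∀ x, IsFiniteMeasure (κ x).variation] (hκT : ∀ f x, T f x = mulIntegral (κ x) f)
    {A : Set E} (hA : MeasurableSet A) : MemC0 fun x => κ x A := by
  have := fun x => (hκ x).innerRegular
  have hW := hT (Metric.closedBall 0 1) Metric.isBounded_closedBall
  have hcl := (hW.image continuous_coe_toWeakSpace_symm).isClosed
  suffices h : (fun x => κ x A) ∈ closure ((fun (w : WeakSpace 𝕜 C₀(E, 𝕜)) (x : E) =>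
      (toWeakSpace 𝕜 C₀(E, 𝕜)).symm w x) ''
      closure (toWeakSpace 𝕜 C₀(E, 𝕜) '' (T '' Metric.closedBall 0 1))) by
    rw [hcl.closure_eq] at h
    obtain ⟨w, -, hw⟩ := h
    exact ⟨(toWeakSpace 𝕜 C₀(E, 𝕜)).symm w, hw⟩
  have hb := Filter.hasBasis_pi fun x : E => Metric.nhds_basis_closedBall (x := κ x A)
  rw [← nhds_pi] at hb
  rw [mem_closure_iff_nhds_basis hb]
  rintro ⟨I, ε⟩ ⟨hI, hε⟩
  obtain ⟨δ, hδ, hδε⟩ : ∃ δ : ℝ, 0 < δ ∧ ∀ i ∈ I, δ ≤ ε i := by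
    rcases I.eq_empty_or_nonempty with rfl | hne
    · exact ⟨1, one_pos, by simp⟩
    · obtain ⟨i, hi, hmin⟩ := I.exists_min_image ε hI hne
      exact ⟨ε i, hε i hi, hmin⟩
  have hs : Measurable (A.indicator fun _ => (1 : 𝕜)) := measurable_const.indicator hA
  have hsb : ∀ x, ‖A.indicator (fun _ => (1 : 𝕜)) x‖ ≤ 1 := fun x => by
    by_cases hx : x ∈ A <;> simp [hx]
  have hsi : ∀ ρ : Measure E, IsFiniteMeasure ρ →
      Integrable (A.indicator fun _ => (1 : 𝕜)) ρ := fun ρ _ =>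
    Integrable.of_bound hs.aestronglyMeasurable 1 (.of_forall hsb)
  -- A basic neighbourhood in the product topology involves finitely many points; summing their
  -- variations lets one f work at all of them.
  obtain ⟨f, hf1, hf⟩ := exists_zeroAtInfty_integral_sub_le
    (∑ i ∈ hI.toFinset, (κ i).variation) hs.aestronglyMeasurable hsb hδ
  refine ⟨fun x => T f x, ⟨toWeakSpace 𝕜 C₀(E, 𝕜) (T f), subset_closure ?_, rfl⟩, ?_⟩
  · exact Set.mem_image_of_mem _ (Set.mem_image_of_mem _ (by simpa using hf1))
  · intro i hi
    rw [Metric.mem_closedBall, dist_eq_norm]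
    change ‖T f i - κ i A‖ ≤ ε i
    rw [hκT]
    have h1 := norm_mulIntegral_sub_le (κ i) (f.integrable _) (hsi _ inferInstance)
    rw [mulIntegral_indicator _ hA, one_mul] at h1
    refine (h1.trans ?_).trans (hf.trans (hδε i hi))
    refine integral_mono_measure ?_ (.of_forall fun _ => norm_nonneg _)
      ((f.integrable _).sub (hsi _ inferInstance)).norm
    exact Finset.single_le_sum (f := fun i => (κ i).variation) (fun _ _ => Measure.zero_le _)
      (hI.mem_toFinset.2 hi)

/-- A weakly compact operator is given by a kernel whose values on each Borel set form a function in
`C₀(E)`. -/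
theorem IsWeaklyCompactOperator.exists_kernel {T : C₀(E, 𝕜) →L[𝕜] C₀(E, 𝕜)}
    (hT : IsWeaklyCompactOperator T) :
    ∃ k : BoundedKernel 𝕜 E, IsKernelOf k T ∧
      ∀ A : Set E, MeasurableSet A → MemC0 fun x => k.toMeasure x A := by
  obtain ⟨κ, hκ, hκT, hκf⟩ := exists_family_eq_mulIntegral T
  have hfin : ∀ x, IsFiniteMeasure (κ x).variation := fun x =>
    ⟨(hκT x).trans_lt ENNReal.ofReal_lt_top⟩
  have hC0 : ∀ A : Set E, MeasurableSet A → MemC0 fun x => κ x A := fun A hA =>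
    hT.memC0 hκ hκf hA
  refine ⟨⟨κ, fun A hA => ?_, hκ, ?_⟩, hκf, hC0⟩
  · obtain ⟨f, hf⟩ := hC0 A hA
    rw [← hf]
    exact (map_continuous f).measurable
  · exact (iSup_le hκT).trans_lt ENNReal.ofReal_lt_top

/-- `eventually_norm_sub_le` at the evaluation functional is uniform over the unit ball, and
`tvNorm_le` converts such uniformity into total variation. -/
theorem IsCompactOperator.isTVContinuous {T : C₀(E, 𝕜) →L[𝕜] C₀(E, 𝕜)}
    (hT : IsCompactOperator T) {k : BoundedKernel 𝕜 E} (hk : IsKernelOf k T) :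
    k.IsTVContinuous := by
  intro x
  refine Metric.tendsto_nhds.2 fun ε hε => ?_
  have hL1 : ‖ZeroAtInftyContinuousMap.evalCLM 𝕜 x‖ ≤ 1 :=
    LinearMap.mkContinuous_norm_le _ zero_le_one _
  filter_upwards [hT.eventually_norm_sub_le _ hL1 (fun f => (map_continuous f).tendsto x)
    (half_pos hε)] with y hy
  have h1 : tvNorm (k.toMeasure y - k.toMeasure x) ≤ ε / 2 :=
    ((k.radon y).sub (k.radon x)).tvNorm_le fun f hf => by
      rw [mulIntegral_sub_vectorMeasure]
      have := hy f hf
      rwa [ZeroAtInftyContinuousMap.evalCLM_apply, hk f y, hk f x] at this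
  rw [Real.dist_0_eq_abs, abs_of_nonneg (tvNorm_nonneg _)]
  linarith

/-- Decay uses the same uniform estimate along the cocompact filter, with limit functional 0. -/
theorem IsCompactOperator.memC0_tvNorm {T : C₀(E, 𝕜) →L[𝕜] C₀(E, 𝕜)}
    (hT : IsCompactOperator T) {k : BoundedKernel 𝕜 E} (hk : IsKernelOf k T) :
    MemC0 fun x => tvNorm (k.toMeasure x) := by
  refine ⟨⟨⟨_, (hT.isTVContinuous hk).continuous_tvNorm⟩, ?_⟩, rfl⟩
  refine Metric.tendsto_nhds.2 fun ε hε => ?_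
  filter_upwards [hT.eventually_norm_sub_le (0 : StrongDual 𝕜 C₀(E, 𝕜))
    (ContinuousLinearMap.opNorm_le_bound _ zero_le_one fun f => by simp)
    (fun f => zero_at_infty f) (half_pos hε)] with y hy
  have h1 : tvNorm (k.toMeasure y) ≤ ε / 2 := (k.radon y).tvNorm_le fun f hf => by
    have := hy f hf
    rwa [_root_.zero_apply, sub_zero, hk f y] at this
  change dist (tvNorm (k.toMeasure y)) 0 < ε
  rw [Real.dist_0_eq_abs, abs_of_nonneg (tvNorm_nonneg _)]
  linarith

end Kernels

/-! ### A double-sequence criterion for weak compactness. -/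

section WeakCompactness

variable {𝕜 : Type*} [RCLike 𝕜] {Y : Type*} [NormedAddCommGroup Y] [NormedSpace 𝕜 Y]

/-- A functional that is small on the unit balls of the annihilators of suitable finite subsets of a
complete space of functionals belongs to this space. -/
theorem mem_range_of_forall_exists_finset {Z : Type*} [NormedAddCommGroup Z] [NormedSpace 𝕜 Z]
    [CompleteSpace Y] (j : Y →ₗᵢ[𝕜] StrongDual 𝕜 Z) (Φ : StrongDual 𝕜 Z)
    (h : ∀ ε : ℝ, 0 < ε → ∃ t : Finset Y, ∀ ν : Z, (∀ y ∈ t, j y ν = 0) → ‖ν‖ ≤ 1 →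
      ‖Φ ν‖ ≤ ε) :
    Φ ∈ Set.range j := by
  have hclosed : IsClosed (Set.range j) := j.isometry.isClosedEmbedding.isClosed_range
  rw [← hclosed.closure_eq, Metric.mem_closure_iff]
  intro ε hε
  obtain ⟨t, ht⟩ := h (ε / 2) (half_pos hε)
  let V : Submodule 𝕜 Z := ⨅ y : t, LinearMap.ker (j (y : Y)).toLinearMap
  have hV : ∀ ν ∈ V, ∀ y ∈ t, j y ν = 0 := fun ν hν y hy => by
    simp only [V, Submodule.mem_iInf] at hν
    exact hν ⟨y, hy⟩
  have hbd : ‖Φ.comp V.subtypeL‖ ≤ ε / 2 := by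
    refine ContinuousLinearMap.opNorm_le_bound _ (by positivity) fun v => ?_
    rcases eq_or_ne v 0 with rfl | hv
    · simp
    have hv' : ‖v‖ ≠ 0 := norm_ne_zero_iff.2 hv
    have h1 := ht ((‖v‖ : 𝕜)⁻¹ • (v : Z)) (hV _ (V.smul_mem _ v.2)) (by
        rw [norm_smul, norm_inv, RCLike.norm_ofReal, abs_norm]
        exact (inv_mul_cancel₀ hv').le)
    rw [map_smul, norm_smul, norm_inv, RCLike.norm_ofReal, abs_norm,
      inv_mul_le_iff₀ (by positivity)] at h1
    rw [mul_comm]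
    exact h1
  -- Φ' has norm at most ε/2 and agrees with Φ on the annihilator V, so Φ - Φ' is a linear
  -- combination of the j y with y ∈ t. Thus Φ is within ε/2 of the range of j.
  obtain ⟨Φ', hΦ', hΦ'n⟩ := exists_extension_norm_eq V (Φ.comp V.subtypeL)
  have hspan := mem_span_of_iInf_ker_le_ker
    (L := fun y : t => (j (y : Y)).toLinearMap)
    (K := (Φ - Φ').toLinearMap) (fun ν hν => by
      have h1 : Φ' ν = Φ ν := hΦ' ⟨ν, hν⟩
      simp [h1])
  let i : Y →ₗ[𝕜] (Z →ₗ[𝕜] 𝕜) :=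
    { toFun := fun y => (j y).toLinearMap
      map_add' := fun _ _ => by ext; simp
      map_smul' := fun _ _ => by ext; simp }
  have hle : Submodule.span 𝕜 (Set.range fun y : t => (j (y : Y)).toLinearMap)
      ≤ LinearMap.range i := by
    rw [Submodule.span_le]
    rintro _ ⟨y, rfl⟩
    exact ⟨y, rfl⟩
  obtain ⟨y, hy⟩ := hle hspan
  refine ⟨_, ⟨y, rfl⟩, ?_⟩
  have heq : Φ - j y = Φ' := by
    ext ν
    have h1 : j y ν = (Φ - Φ') ν := LinearMap.congr_fun hy ν
    rw [_root_.sub_apply, h1, _root_.sub_apply]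
    ring
  rw [dist_eq_norm, heq, hΦ'n]
  linarith

/-- A sequential criterion for weak compactness in a Banach space. -/
theorem isCompact_closure_toWeakSpace [CompleteSpace Y] {S : Set Y} (hb : Bornology.IsBounded S)
    (H : ∀ (ν : ℕ → StrongDual 𝕜 Y) (y : ℕ → Y) (L : ℕ → 𝕜) (ε : ℝ), 0 < ε → (∀ n, ‖ν n‖ ≤ 1) →
      (∀ n, y n ∈ S) → (∀ m n, m < n → ν n (y m) = 0) →
      (∀ m, Tendsto (fun n => ν m (y n)) atTop (𝓝 (L m))) → (∀ m, ε ≤ ‖L m‖) → False) :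
    IsCompact (closure (toWeakSpace 𝕜 Y '' S)) := by
  refine NormedSpace.isCompact_closure_of_isBounded 𝕜 Y _ ?_ ?_
  · rwa [Set.preimage_image_eq _ (toWeakSpace 𝕜 Y).injective]
  -- It remains to see that every weak-star limit point Φ of S in the bidual comes from Y.
  intro Φ hΦ
  have happrox : ∀ (s : Finset (StrongDual 𝕜 Y)) (δ : ℝ), 0 < δ →
      ∃ y ∈ S, ∀ ν ∈ s, ‖ν y - Φ ν‖ < δ := by
    intro s δ hδ
    have hopen : IsOpen {Ψ : WeakDual 𝕜 (StrongDual 𝕜 Y) | ∀ ν ∈ s, ‖Ψ ν - Φ ν‖ < δ} := by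
      simp only [Set.ofPred_forall]
      refine isOpen_biInter_finset fun ν _ => ?_
      exact isOpen_lt ((WeakDual.eval_continuous ν).sub continuous_const).norm continuous_const
    obtain ⟨_, hΨ, _, ⟨y, hy, rfl⟩, rfl⟩ := mem_closure_iff.1 hΦ _ hopen
      (fun ν _ => by simpa using hδ)
    exact ⟨y, hy, fun ν hν => hΨ ν hν⟩
  by_contra hnot
  have hnot' : (WeakDual.toStrongDual Φ) ∉ Set.range (NormedSpace.inclusionInDoubleDual 𝕜 Y) := by
    rintro ⟨y, hy⟩
    exact hnot ⟨toWeakSpace 𝕜 Y y, congrArg StrongDual.toWeakDual hy⟩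
  have hfar : ∃ ε : ℝ, 0 < ε ∧ ∀ t : Finset Y, ∃ ν : StrongDual 𝕜 Y, (∀ y ∈ t, ν y = 0) ∧
      ‖ν‖ ≤ 1 ∧ ε ≤ ‖Φ ν‖ := by
    by_contra! hcon
    refine hnot' (mem_range_of_forall_exists_finset
      (NormedSpace.inclusionInDoubleDualLi (𝕜 := 𝕜) (E := Y)) _ fun ε hε => ?_)
    obtain ⟨t, ht⟩ := hcon ε hε
    exact ⟨t, fun ν h1 h2 => (ht ν h1 h2).le⟩
  obtain ⟨ε, hε, hfar⟩ := hfar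
  classical
  -- Each new ν kills all earlier y, and each new y approximates Φ on all earlier ν. The third
  -- component is a strictly increasing counter that drives the tolerance to zero.
  obtain ⟨f, hfP, hfr⟩ := exists_seq_of_forall_finset_exists
    (fun a : StrongDual 𝕜 Y × Y × ℕ => ‖a.1‖ ≤ 1 ∧ a.2.1 ∈ S ∧ ε ≤ ‖Φ a.1‖)
    (fun a b => b.1 a.2.1 = 0 ∧ ‖a.1 b.2.1 - Φ a.1‖ < 1 / (b.2.2 + 1) ∧ a.2.2 < b.2.2)
    (fun s _ => by
      obtain ⟨ν, hν0, hν1, hνε⟩ := hfar (s.image fun a => a.2.1)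
      obtain ⟨y, hy, hyν⟩ := happrox (s.image fun a => a.1)
        (1 / (((s.sup fun a => a.2.2) + 1 : ℕ) + 1)) (by positivity)
      refine ⟨(ν, y, (s.sup fun a => a.2.2) + 1), ⟨hν1, hy, hνε⟩, fun a ha => ⟨?_, ?_, ?_⟩⟩
      · exact hν0 _ (Finset.mem_image_of_mem _ ha)
      · exact hyν _ (Finset.mem_image_of_mem _ ha)
      · exact Nat.lt_succ_of_le (Finset.le_sup (f := fun a => a.2.2) ha))
  have hmono : StrictMono fun n => (f n).2.2 := strictMono_nat_of_lt_succ fun n =>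
    (hfr n (n + 1) n.lt_succ_self).2.2
  refine H (fun n => (f n).1) (fun n => (f n).2.1) (fun n => Φ (f n).1) ε hε
    (fun n => (hfP n).1) (fun n => (hfP n).2.1) (fun m n hmn => (hfr m n hmn).1) (fun m => ?_)
    fun n => (hfP n).2.2
  rw [tendsto_iff_norm_sub_tendsto_zero]
  refine squeeze_zero' (.of_forall fun _ => norm_nonneg _) ?_
    tendsto_one_div_add_atTop_nhds_zero_nat
  filter_upwards [eventually_gt_atTop m] with n hn
  refine (hfr m n hn).2.1.le.trans ?_
  have : (n : ℝ) ≤ (f n).2.2 := by exact_mod_cast hmono.id_le n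
  gcongr

end WeakCompactness

/-! ### Weak limits of functionals and of bounded functions. -/

section WeakLimits

variable {𝕜 : Type*} [RCLike 𝕜] {X : Type*} [MeasurableSpace X]

/-- Bounded sequences in a dual space have weak-star limits along ultrafilters. -/
theorem exists_strongDual_tendsto {Y : Type*} [NormedAddCommGroup Y] [NormedSpace 𝕜 Y]
    {φ : ℕ → StrongDual 𝕜 Y} {C : ℝ} (hφ : ∀ n, ‖φ n‖ ≤ C) (l : Ultrafilter ℕ) :
    ∃ ψ : StrongDual 𝕜 Y, ‖ψ‖ ≤ C ∧ ∀ y, Tendsto (fun n => φ n y) l (𝓝 (ψ y)) := by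
  obtain ⟨ψ, hψ, hle⟩ := (WeakDual.isCompact_closedBall (𝕜 := 𝕜) (0 : StrongDual 𝕜 Y)
    C).ultrafilter_le_nhds' (l.map fun n => StrongDual.toWeakDual (φ n))
    (Filter.mem_map.2 (Filter.univ_mem' fun n => by simpa using hφ n))
  refine ⟨WeakDual.toStrongDual ψ, by simpa using hψ, fun y => ?_⟩
  exact ((WeakDual.eval_continuous y).tendsto ψ).comp hle

/-- Bounded sequences in a Hilbert space have weak limits along ultrafilters. -/
theorem exists_inner_tendsto {H : Type*} [NormedAddCommGroup H] [InnerProductSpace 𝕜 H]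
    [CompleteSpace H] {u : ℕ → H} {C : ℝ} (hu : ∀ n, ‖u n‖ ≤ C) (l : Ultrafilter ℕ) :
    ∃ v : H, ∀ h : H, Tendsto (fun n => inner 𝕜 h (u n)) l (𝓝 (inner 𝕜 h v)) := by
  obtain ⟨ψ, -, hψ⟩ := exists_strongDual_tendsto (φ := fun n => InnerProductSpace.toDual 𝕜 H (u n))
    (C := C) (fun n => by simpa using hu n) l
  refine ⟨(InnerProductSpace.toDual 𝕜 H).symm ψ, fun h => ?_⟩
  have h1 := (RCLike.continuous_conj.tendsto _).comp (hψ h)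
  rw [← inner_conj_symm h, InnerProductSpace.toDual_symm_apply]
  simpa [Function.comp_def, InnerProductSpace.toDual_apply_apply, inner_conj_symm] using h1

/-- The integral against a measure dominated by `ρ` is represented by an element of `L²(ρ)`. -/
theorem exists_inner_eq_mulIntegral {ρ : Measure X} [IsFiniteMeasure ρ] {μ : VectorMeasure X 𝕜}
    {C : ℝ≥0} (hμ : μ.variation ≤ C • ρ) :
    ∃ v : Lp 𝕜 2 ρ, ∀ h : Lp 𝕜 2 ρ, mulIntegral μ h = inner 𝕜 v h := by
  have hac : μ.variation ≪ ρ :=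
    (Measure.absolutelyContinuous_of_le hμ).trans (Measure.smul_absolutelyContinuous)
  have hint : ∀ h : Lp 𝕜 2 ρ, Integrable h μ.variation := fun h =>
    (((Lp.memLp h).integrable one_le_two).smul_measure_nnreal (c := C)).mono_measure hμ
  let M₀ : Lp 𝕜 2 ρ →ₗ[𝕜] 𝕜 :=
    { toFun := fun h => mulIntegral μ h
      map_add' := fun f g => by
        rw [← mulIntegral_add μ (hint f) (hint g)]
        exact VectorMeasure.integral_congr_ae (hac.ae_le (Lp.coeFn_add f g))
      map_smul' := fun c f => by
        rw [RingHom.id_apply, smul_eq_mul, ← mulIntegral_const_mul]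
        exact VectorMeasure.integral_congr_ae (hac.ae_le (Lp.coeFn_smul c f)) }
  let M : StrongDual 𝕜 (Lp 𝕜 2 ρ) := M₀.mkContinuous
    (C * (ρ Set.univ ^ (2⁻¹ : ℝ)).toReal) fun h => by
    refine (norm_mulIntegral_le μ h).trans ?_
    have h1 : ∫ x, ‖h x‖ ∂μ.variation ≤ C * ∫ x, ‖h x‖ ∂ρ := by
      refine (integral_mono_measure hμ (.of_forall fun _ => norm_nonneg _) ?_).trans_eq ?_
      · exact (((Lp.memLp h).integrable one_le_two).smul_measure_nnreal (c := C)).norm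
      · rw [integral_smul_nnreal_measure]; rfl
    refine h1.trans ?_
    rw [mul_assoc]
    refine mul_le_mul_of_nonneg_left ?_ C.2
    have h2 := eLpNorm_le_eLpNorm_mul_rpow_measure_univ (μ := ρ) (p := 1) (q := 2) one_le_two
      (Lp.memLp h).aestronglyMeasurable
    rw [Lp.norm_def, mul_comm, ← ENNReal.toReal_mul]
    rw [eLpNorm_one_eq_lintegral_enorm] at h2
    rw [integral_norm_eq_lintegral_enorm (Lp.memLp h).aestronglyMeasurable]
    refine ENNReal.toReal_mono ?_ (h2.trans_eq ?_)
    · exact ENNReal.mul_ne_top (Lp.memLp h).eLpNorm_ne_top (by finiteness)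
    · norm_num
  refine ⟨(InnerProductSpace.toDual 𝕜 _).symm M, fun h => ?_⟩
  rw [InnerProductSpace.toDual_symm_apply]
  rfl

/-- A weak limit in `L²` of functions bounded by `R` is bounded by `R`. -/
theorem ae_norm_le_of_tendsto_inner {ρ : Measure X} [IsFiniteMeasure ρ] {ι : Type*} {l : Filter ι}
    [l.NeBot] {u : ι → Lp 𝕜 2 ρ} {v : Lp 𝕜 2 ρ} {R : ℝ} (hu : ∀ i, ∀ᵐ x ∂ρ, ‖u i x‖ ≤ R)
    (hv : ∀ h : Lp 𝕜 2 ρ, Tendsto (fun i => inner 𝕜 h (u i)) l (𝓝 (inner 𝕜 h v))) :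
    ∀ᵐ x ∂ρ, ‖v x‖ ≤ R := by
  classical
  have hvm : StronglyMeasurable v := Lp.stronglyMeasurable v
  let A : Set X := {x | R < ‖v x‖}
  have hA : MeasurableSet A := measurableSet_lt measurable_const hvm.norm.measurable
  -- Testing against the phase of v on A gives ∫_A ‖v‖ ≤ R ρ(A), while ‖v‖ > R on A; hence A is
  -- null.
  let h : X → 𝕜 := A.indicator fun x => ((‖v x‖⁻¹ : ℝ) : 𝕜) * v x
  have hhm : StronglyMeasurable h :=
    ((RCLike.continuous_ofReal.comp_stronglyMeasurable
      hvm.norm.measurable.inv.stronglyMeasurable).mul hvm).indicator hA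
  have hh1 : ∀ x, ‖h x‖ ≤ A.indicator (fun _ => (1 : ℝ)) x := fun x => by
    by_cases hx : x ∈ A
    · simp only [h, Set.indicator_of_mem hx]
      rw [norm_mul, RCLike.norm_ofReal, abs_inv, abs_norm]
      exact inv_mul_le_one
    · simp [h, hx]
  have hh : MemLp h 2 ρ := MemLp.of_bound hhm.aestronglyMeasurable 1 (.of_forall fun x =>
    (hh1 x).trans (Set.indicator_le_self' (fun _ _ => zero_le_one) x))
  have hin : ∀ w : Lp 𝕜 2 ρ, inner 𝕜 (hh.toLp h) w = ∫ x, inner 𝕜 (h x) (w x) ∂ρ := fun w => by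
    rw [L2.inner_def]
    refine integral_congr_ae ?_
    filter_upwards [hh.coeFn_toLp] with x hx
    rw [hx]
  have hle : ∀ i, ‖inner 𝕜 (hh.toLp h) (u i)‖ ≤ ∫ x, A.indicator (fun _ => R) x ∂ρ := fun i => by
    rw [hin]
    refine norm_integral_le_of_norm_le ((integrable_const R).indicator hA) ?_
    filter_upwards [hu i] with x hx
    refine (norm_inner_le_norm _ _).trans ?_
    by_cases hxA : x ∈ A
    · have := hh1 x
      rw [Set.indicator_of_mem hxA] at this ⊢
      exact (mul_le_mul this hx (norm_nonneg _) zero_le_one).trans_eq (one_mul R)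
    · simp [h, hxA]
  have hlim : ‖inner 𝕜 (hh.toLp h) v‖ ≤ ∫ x, A.indicator (fun _ => R) x ∂ρ :=
    le_of_tendsto (hv _).norm (.of_forall hle)
  have hval : inner 𝕜 (hh.toLp h) v = ((∫ x, A.indicator (fun x => ‖v x‖) x ∂ρ : ℝ) : 𝕜) := by
    rw [hin, ← integral_ofReal]
    refine integral_congr_ae (.of_forall fun x => ?_)
    by_cases hx : x ∈ A
    · simp only [h, Set.indicator_of_mem hx]
      rw [← smul_eq_mul, inner_smul_left, RCLike.conj_ofReal, inner_self_eq_norm_sq_to_K]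
      rcases eq_or_ne (‖v x‖) 0 with h0 | h0
      · simp [h0]
      · rw [← RCLike.ofReal_pow, ← RCLike.ofReal_mul]
        congr 1
        field_simp
    · simp [h, hx]
  have hvi : Integrable (fun x => ‖v x‖) ρ := ((Lp.memLp v).integrable one_le_two).norm
  have hAi : Integrable (A.indicator fun x => ‖v x‖ - R) ρ :=
    (hvi.sub (integrable_const R)).indicator hA
  have hnn : 0 ≤ A.indicator fun x => ‖v x‖ - R :=
    Set.indicator_nonneg fun x hx => sub_nonneg.2 (le_of_lt hx)
  have hzero : ∫ x, A.indicator (fun x => ‖v x‖ - R) x ∂ρ = 0 := by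
    refine le_antisymm ?_ (integral_nonneg hnn)
    rw [hval, RCLike.norm_ofReal] at hlim
    have h1 := (le_abs_self _).trans hlim
    rw [integral_indicator hA] at h1 ⊢
    rw [integral_indicator hA] at h1
    rw [integral_sub hvi.integrableOn (integrable_const R)]
    linarith
  rw [integral_eq_zero_iff_of_nonneg hnn hAi] at hzero
  filter_upwards [hzero] with x hx
  by_contra hcon
  have hxA : x ∈ A := not_le.1 hcon
  rw [Set.indicator_of_mem hxA] at hx
  exact hcon (sub_nonpos.1 hx.le)

/-- Uniformly bounded measurable functions have limits along an ultrafilter, in the sense of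
integrals against all measures dominated by a given finite measure. -/
theorem exists_measurable_tendsto_mulIntegral (ρ : Measure X) [IsFiniteMeasure ρ]
    {f : ℕ → X → 𝕜} (hf : ∀ n, Measurable (f n)) {R : ℝ} (hR : 0 ≤ R) (hfR : ∀ n x, ‖f n x‖ ≤ R)
    (l : Ultrafilter ℕ) :
    ∃ g : X → 𝕜, Measurable g ∧ (∀ x, ‖g x‖ ≤ R) ∧ ∀ (μ : VectorMeasure X 𝕜) (C : ℝ≥0),
      μ.variation ≤ C • ρ → Tendsto (fun n => mulIntegral μ (f n)) l (𝓝 (mulIntegral μ g)) := by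
  classical
  have hfL : ∀ n, MemLp (f n) 2 ρ := fun n =>
    MemLp.of_bound (hf n).aestronglyMeasurable R (.of_forall (hfR n))
  obtain ⟨v, hv⟩ := exists_inner_tendsto (𝕜 := 𝕜) (u := fun n => (hfL n).toLp (f n))
    (fun n => Lp.norm_le_of_ae_bound hR (by
      filter_upwards [(hfL n).coeFn_toLp] with x hx
      rw [hx]
      exact hfR n x)) l
  have hvR := ae_norm_le_of_tendsto_inner (R := R) (fun n => by
    filter_upwards [(hfL n).coeFn_toLp] with x hx
    rw [hx]
    exact hfR n x) hv
  have hvm : Measurable v := (Lp.stronglyMeasurable v).measurable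
  -- The weak L² limit v is bounded by R only almost everywhere; cutting it off makes the bound hold
  -- at every point.
  refine ⟨{x | ‖v x‖ ≤ R}.indicator v, hvm.indicator (measurableSet_le hvm.norm measurable_const),
    fun x => ?_, fun μ C hμ => ?_⟩
  · by_cases hx : ‖v x‖ ≤ R
    · rwa [Set.indicator_of_mem (by exact hx)]
    · rwa [Set.indicator_of_notMem (by exact hx), norm_zero]
  · have hac : μ.variation ≪ ρ :=
      (Measure.absolutelyContinuous_of_le hμ).trans (Measure.smul_absolutelyContinuous)
    obtain ⟨w, hw⟩ := exists_inner_eq_mulIntegral hμ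
    have h1 : mulIntegral μ ({x | ‖v x‖ ≤ R}.indicator v) = inner 𝕜 w v := by
      rw [← hw]
      refine VectorMeasure.integral_congr_ae (hac.ae_le ?_)
      filter_upwards [hvR] with x hx
      rw [Set.indicator_of_mem (by exact hx)]
    have h2 : ∀ n, mulIntegral μ (f n) = inner 𝕜 w ((hfL n).toLp (f n)) := fun n => by
      rw [← hw]
      exact VectorMeasure.integral_congr_ae (hac.ae_le (hfL n).coeFn_toLp.symm)
    simp only [h1, h2]
    exact hv w

/-- A sequence of finite measures is dominated by a single finite measure. -/
theorem exists_isFiniteMeasure_forall_le_smul (μ : ℕ → Measure X) [∀ n, IsFiniteMeasure (μ n)] :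
    ∃ ρ : Measure X, IsFiniteMeasure ρ ∧ ∀ n, ∃ C : ℝ≥0, μ n ≤ C • ρ := by
  obtain ⟨c, hc, hsum⟩ := ENNReal.exists_pos_tsum_mul_lt_of_countable
    (one_ne_zero : (1 : ℝ≥0∞) ≠ 0) (fun n => μ n Set.univ) fun n => measure_ne_top _ _
  refine ⟨Measure.sum fun n => c n • μ n, ⟨?_⟩, fun n => ⟨(c n)⁻¹, ?_⟩⟩
  · rw [Measure.sum_apply _ MeasurableSet.univ]
    refine lt_of_eq_of_lt ?_ (hsum.trans ENNReal.one_lt_top)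
    exact tsum_congr fun n => mul_comm _ _
  · have h1 : μ n = (c n)⁻¹ • (c n • μ n) := by
      rw [smul_smul, inv_mul_cancel₀ (hc n).ne', one_smul]
    conv_lhs => rw [h1]
    intro s
    simp only [Measure.smul_apply]
    gcongr
    exact Measure.le_sum (fun n => c n • μ n) n s

end WeakLimits

/-! ### Setwise bounds by the total variation norm. -/

section TotalVariationBounds

variable {𝕜 : Type*} [RCLike 𝕜] {E : Type*} [MeasurableSpace E]

theorem norm_vectorMeasure_apply_le_tvNorm (μ : VectorMeasure E 𝕜) [IsFiniteMeasure μ.variation]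
    (A : Set E) : ‖μ A‖ ≤ tvNorm μ :=
  (VectorMeasure.norm_measure_le_variation (measure_ne_top _ _)).trans
    (ENNReal.toReal_mono (measure_ne_top _ _) (measure_mono A.subset_univ))

theorem sum_norm_vectorMeasure_le_tvNorm (μ : VectorMeasure E 𝕜) [IsFiniteMeasure μ.variation]
    {P : Finset (Set E)} (hP : (P : Set (Set E)).PairwiseDisjoint id) :
    ∑ p ∈ P, ‖μ p‖ ≤ tvNorm μ := by
  have h1 := μ.le_variation MeasurableSet.univ (fun t (_ : t ∈ P) => t.subset_univ) hP
  have h2 := ENNReal.toReal_mono (measure_ne_top _ _) h1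
  rw [ENNReal.toReal_sum fun _ _ => enorm_ne_top] at h2
  simpa [tvNorm] using h2

end TotalVariationBounds

/-! ### Kernels with setwise values in C₀(E) give weakly compact operators. -/

section SetwiseC0

variable {𝕜 : Type*} [RCLike 𝕜] {E : Type*} [TopologicalSpace E] [MeasurableSpace E]

/-- If the values of a kernel on each Borel set form functions in `C₀(E)`, then every functional on
`C₀(E)`, applied to these functions, gives a vector measure. -/
theorem BoundedKernel.exists_vectorMeasure_of_strongDual [T2Space E]
    [LocallyCompactSpace E] [BorelSpace E] (k : BoundedKernel 𝕜 E)
    {F : Set E → C₀(E, 𝕜)} (hF : ∀ A x, F A x = k.toMeasure x A) (ν : StrongDual 𝕜 C₀(E, 𝕜)) :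
    ∃ μ : VectorMeasure E 𝕜, μ.variation Set.univ ≤ ENNReal.ofReal (‖ν‖ * k.bound) ∧
      ∀ A, μ A = ν (F A) := by
  classical
  -- Partial sums of k(x, ·) over disjoint sets converge for each x, with error at most twice
  -- `k.bound`. Since ν is dominated by integration against ρ, dominated convergence makes A ↦ ν (F
  -- A) countably additive.
  obtain ⟨ρ, hρfin, -, -, hρ⟩ := exists_measure_norm_le_integral ν
  let μ : VectorMeasure E 𝕜 :=
    { measureOf' := fun A => ν (F A)
      empty' := by
        have : F ∅ = 0 := by ext x; simp [hF]
        simp [this]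
      not_measurable' := fun A hA => by
        have : F A = 0 := by ext x; simp [hF, VectorMeasure.not_measurable _ hA]
        simp [this]
      m_iUnion' := fun f hf hd => by
        rw [HasSum, tendsto_iff_norm_sub_tendsto_zero]
        have hG : ∀ (s : Finset ℕ) x, (∑ i ∈ s, F (f i) - F (⋃ i, f i)) x =
            ∑ i ∈ s, k.toMeasure x (f i) - k.toMeasure x (⋃ i, f i) := fun s x => by
          rw [ZeroAtInftyContinuousMap.sub_apply, hF, ← ZeroAtInftyContinuousMap.evalCLM_apply,
            map_sum]
          simp [hF]
        have hint : Tendsto (fun s : Finset ℕ => ∫ x, ‖(∑ i ∈ s, F (f i) - F (⋃ i, f i)) x‖ ∂ρ)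
            (atTop ⊓ 𝓟 Set.univ) (𝓝 (∫ _, (0 : ℝ) ∂ρ)) := by
          rw [principal_univ, inf_top_eq]
          refine tendsto_integral_filter_of_dominated_convergence (fun _ => 2 * k.bound)
            (.of_forall fun s => ?_) (.of_forall fun s => .of_forall fun x => ?_)
            (integrable_const _) (.of_forall fun x => ?_)
          · exact (ZeroAtInftyContinuousMap.integrable _ ρ).norm.aestronglyMeasurable
          · rw [norm_norm, hG, ← VectorMeasure.of_biUnion_finset (fun i _ j _ hij => hd hij)
              fun i _ => hf i]
            refine (norm_sub_le _ _).trans ?_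
            have h1 := norm_vectorMeasure_apply_le_tvNorm (k.toMeasure x)
            linarith [h1 (⋃ i ∈ s, f i), h1 (⋃ i, f i), k.tvNorm_le_bound x]
          · simp only [hG]
            exact tendsto_iff_norm_sub_tendsto_zero.1 ((k.toMeasure x).m_iUnion hf hd)
        rw [principal_univ, inf_top_eq, integral_zero] at hint
        refine squeeze_zero (fun _ => norm_nonneg _) (fun s => ?_) hint
        rw [← map_sum, ← map_sub]
        exact hρ _ }
  refine ⟨μ, le_of_forall_lt fun a ha => ?_, fun A => rfl⟩
  obtain ⟨P, -, hPd, hPm, hP⟩ := μ.exists_lt_sum_of_lt_variation MeasurableSet.univ ha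
  refine hP.trans_le ?_
  choose c hc1 hc using RCLike.exists_norm_le_one_mul_eq_norm (𝕜 := 𝕜)
  have hsum : ((∑ p ∈ P, ‖μ p‖ : ℝ) : 𝕜) = ν (∑ p ∈ P, c (μ p) • F p) := by
    rw [map_sum, RCLike.ofReal_sum]
    refine Finset.sum_congr rfl fun p _ => ?_
    rw [map_smul, smul_eq_mul, ← hc (μ p)]
    rfl
  have hnorm : ‖∑ p ∈ P, c (μ p) • F p‖ ≤ k.bound := by
    refine (ZeroAtInftyContinuousMap.norm_le k.bound_nonneg).2 fun x => ?_
    rw [← ZeroAtInftyContinuousMap.evalCLM_apply, map_sum]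
    refine (norm_sum_le _ _).trans (le_trans ?_
      ((sum_norm_vectorMeasure_le_tvNorm (k.toMeasure x) hPd).trans (k.tvNorm_le_bound x)))
    refine Finset.sum_le_sum fun p _ => ?_
    rw [map_smul, norm_smul, ZeroAtInftyContinuousMap.evalCLM_apply, hF]
    exact mul_le_of_le_one_left (norm_nonneg _) (hc1 _)
  have h1 : ∑ p ∈ P, ‖μ p‖ ≤ ‖ν‖ * k.bound := by
    have h2 : ‖((∑ p ∈ P, ‖μ p‖ : ℝ) : 𝕜)‖ ≤ ‖ν‖ * k.bound := by
      rw [hsum]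
      exact (ν.le_opNorm _).trans (mul_le_mul_of_nonneg_left hnorm (norm_nonneg ν))
    rw [RCLike.norm_ofReal] at h2
    exact (le_abs_self _).trans h2
  rw [← Finset.sum_congr rfl fun p _ => ofReal_norm (μ p),
    ← ENNReal.ofReal_sum_of_nonneg fun _ _ => norm_nonneg _]
  exact ENNReal.ofReal_le_ofReal h1

/-- If the values of a kernel on each Borel set form functions in `C₀(E)`, then so do the integrals
of each bounded Borel function. -/
theorem BoundedKernel.exists_eq_mulIntegral (k : BoundedKernel 𝕜 E)
    {F : Set E → C₀(E, 𝕜)} (hF : ∀ A x, F A x = k.toMeasure x A)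
    {μ : StrongDual 𝕜 C₀(E, 𝕜) → VectorMeasure E 𝕜} [∀ ν, IsFiniteMeasure (μ ν).variation]
    (hμ : ∀ ν A, μ ν A = ν (F A)) {f : E → 𝕜} (hf : Measurable f) {R : ℝ} (hR : ∀ x, ‖f x‖ ≤ R) :
    ∃ z : C₀(E, 𝕜), (∀ x, z x = mulIntegral (k.toMeasure x) f) ∧
      ∀ ν, ν z = mulIntegral (μ ν) f := by
  classical
  have hsi : ∀ (s : SimpleFunc E 𝕜) (ρ : Measure E) [IsFiniteMeasure ρ], Integrable s ρ :=
    fun s ρ _ => s.integrable_of_isFiniteMeasure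
  have hsimple : ∀ s : SimpleFunc E 𝕜, ∃ z : C₀(E, 𝕜),
      (∀ x, z x = mulIntegral (k.toMeasure x) s) ∧ ∀ ν, ν z = mulIntegral (μ ν) s := by
    intro s
    induction s using SimpleFunc.induction with
    | const c hs =>
      rename_i A
      have h1 : ⇑(SimpleFunc.piecewise A hs (SimpleFunc.const E c) (SimpleFunc.const E 0)) =
          A.indicator fun _ => c := by
        ext x
        by_cases hx : x ∈ A <;> simp [hx]
      refine ⟨c • F A, fun x => ?_, fun ν => ?_⟩
      · rw [h1, mulIntegral_indicator _ hs, ZeroAtInftyContinuousMap.smul_apply, hF, smul_eq_mul]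
      · rw [h1, mulIntegral_indicator _ hs, map_smul, hμ, smul_eq_mul]
    | add _ hs ht =>
      rename_i s t _
      obtain ⟨z, hz1, hz2⟩ := hs
      obtain ⟨w, hw1, hw2⟩ := ht
      refine ⟨z + w, fun x => ?_, fun ν => ?_⟩
      · rw [ZeroAtInftyContinuousMap.add_apply, hz1, hw1]
        exact (mulIntegral_add _ (hsi s _) (hsi t _)).symm
      · rw [map_add, hz2, hw2]
        exact (mulIntegral_add _ (hsi s _) (hsi t _)).symm
  choose s hs using fun n : ℕ => exists_simpleFunc_dist_le hf hR (δ := 1 / (n + 1)) (by positivity)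
  choose z hz1 hz2 using fun n => hsimple (s n)
  have hfi : ∀ (ρ : Measure E) [IsFiniteMeasure ρ], Integrable f ρ := fun ρ _ =>
    Integrable.of_bound hf.aestronglyMeasurable R (.of_forall hR)
  have happrox : ∀ (m : VectorMeasure E 𝕜) [IsFiniteMeasure m.variation] (n : ℕ),
      ‖mulIntegral m (s n) - mulIntegral m f‖ ≤ 1 / (n + 1) * tvNorm m := fun m _ n => by
    rw [← mulIntegral_sub m (hsi _ _) (hfi _)]
    refine norm_mulIntegral_le_of_bound _ fun x => ?_
    rw [norm_sub_rev]
    exact hs n x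
  have hlim : ∀ (m : VectorMeasure E 𝕜) [IsFiniteMeasure m.variation],
      Tendsto (fun n => mulIntegral m (s n)) atTop (𝓝 (mulIntegral m f)) := fun m _ => by
    rw [tendsto_iff_norm_sub_tendsto_zero]
    refine squeeze_zero (fun _ => norm_nonneg _) (happrox m) ?_
    simpa using tendsto_one_div_add_atTop_nhds_zero_nat.mul_const (tvNorm m)
  -- The error bound 1/(N+1) times `k.bound` does not depend on x, so completeness of C₀(E) yields
  -- the limit.
  have hcauchy : CauchySeq z := by
    refine cauchySeq_of_le_tendsto_0 (fun n : ℕ => 2 * (1 / (n + 1) * k.bound))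
      (fun n m N hn hm => ?_) ?_
    · rw [dist_eq_norm]
      have hb := k.bound_nonneg
      refine (ZeroAtInftyContinuousMap.norm_le (by positivity)).2 fun x => ?_
      have key : ∀ i, N ≤ i → ‖z i x - mulIntegral (k.toMeasure x) f‖ ≤ 1 / (N + 1) * k.bound :=
        fun i hi => by
          rw [hz1]
          refine (happrox _ i).trans ?_
          have h1 := k.tvNorm_le_bound x
          have h2 := tvNorm_nonneg (k.toMeasure x)
          have h3 : (N : ℝ) ≤ i := by exact_mod_cast hi
          gcongr
      rw [ZeroAtInftyContinuousMap.sub_apply, ← sub_sub_sub_cancel_right _ _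
        (mulIntegral (k.toMeasure x) f), two_mul]
      exact (norm_sub_le _ _).trans (add_le_add (key n hn) (key m hm))
    · simpa using (tendsto_one_div_add_atTop_nhds_zero_nat.mul_const k.bound).const_mul 2
  obtain ⟨w, hw⟩ := cauchySeq_tendsto_of_complete hcauchy
  refine ⟨w, fun x => ?_, fun ν => ?_⟩
  · refine tendsto_nhds_unique
      (((ZeroAtInftyContinuousMap.evalCLM 𝕜 x).continuous.tendsto w).comp hw) ?_
    simpa [Function.comp_def, hz1] using hlim (k.toMeasure x)
  · refine tendsto_nhds_unique ((ν.continuous.tendsto w).comp hw) ?_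
    simpa [Function.comp_def, hz2] using hlim (μ ν)

/-- The operator given by a kernel whose values on each Borel set form functions in `C₀(E)` is
weakly compact. -/
theorem IsKernelOf.isWeaklyCompactOperator [T2Space E] [LocallyCompactSpace E]
    [BorelSpace E] {T : C₀(E, 𝕜) →L[𝕜] C₀(E, 𝕜)} {k : BoundedKernel 𝕜 E}
    (hk : IsKernelOf k T) (hC0 : ∀ A : Set E, MeasurableSet A → MemC0 fun x => k.toMeasure x A) :
    IsWeaklyCompactOperator T := by
  have hF : ∀ A : Set E, ∃ f : C₀(E, 𝕜), ∀ x, f x = k.toMeasure x A := fun A => by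
    by_cases hA : MeasurableSet A
    · obtain ⟨f, hf⟩ := hC0 A hA
      exact ⟨f, fun x => congrFun hf x⟩
    · exact ⟨0, fun x => by simp [VectorMeasure.not_measurable _ hA]⟩
  choose F hF using hF
  choose μ hμv hμ using k.exists_vectorMeasure_of_strongDual hF
  have hμfin : ∀ ν, IsFiniteMeasure (μ ν).variation := fun ν =>
    ⟨(hμv ν).trans_lt ENNReal.ofReal_lt_top⟩
  have hT : ∀ ν (f : C₀(E, 𝕜)), ν (T f) = mulIntegral (μ ν) f := fun ν f => by
    obtain ⟨z, hz1, hz2⟩ := k.exists_eq_mulIntegral hF hμ (map_continuous f).measurable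
      (fun x => f.norm_apply_le x)
    have : T f = z := by
      ext x
      rw [hz1, hk f x]
    rw [this, hz2]
  intro B hB
  obtain ⟨R, hR, hBR⟩ := hB.exists_pos_norm_le
  have hTB : Bornology.IsBounded (T '' B) := T.lipschitz.isBounded_image hB
  refine isCompact_closure_toWeakSpace hTB fun ν y L ε hε hν hy hzero hlim hL => ?_
  choose f hfB hfy using hy
  obtain ⟨ψ, -, hψ⟩ := exists_strongDual_tendsto hν (hyperfilter ℕ)
  -- One ρ must dominate the measures of ψ and of all ν n; index 0 stands for ψ and index n + 1 for
  -- ν n.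
  obtain ⟨ρ, hρ, hdom⟩ := exists_isFiniteMeasure_forall_le_smul
    (fun n : ℕ => (μ (Nat.casesOn n ψ ν)).variation)
  obtain ⟨g, hg, hgR, hlimg⟩ := exists_measurable_tendsto_mulIntegral ρ (f := fun n x => f n x)
    (fun n => (map_continuous (f n)).measurable) hR.le
    (fun n x => ((f n).norm_apply_le x).trans (hBR _ (hfB n))) (hyperfilter ℕ)
  have hle : ((hyperfilter ℕ : Ultrafilter ℕ) : Filter ℕ) ≤ atTop := Nat.hyperfilter_le_atTop
  -- z is the value at g of the extension of T. As the limit of ν m z = L m, ψ z has norm at least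
  -- ε; as the limit of ψ (y n) = 0, it vanishes.
  obtain ⟨z, -, hz⟩ := k.exists_eq_mulIntegral hF hμ hg hgR
  have hzL : ∀ m, ν m z = L m := fun m => by
    obtain ⟨C, hC⟩ := hdom (m + 1)
    refine tendsto_nhds_unique ?_ ((hlim m).mono_left hle)
    have := hlimg _ C hC
    rw [hz]
    refine this.congr fun n => ?_
    rw [← hfy, hT]
  have hzero' : ∀ n, ψ (y n) = 0 := fun n => by
    refine tendsto_nhds_unique (hψ (y n)) (tendsto_const_nhds.congr' ?_)
    filter_upwards [hle (eventually_gt_atTop n)] with m hm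
    exact (hzero n m hm).symm
  have hψz : ψ z = 0 := by
    obtain ⟨C, hC⟩ := hdom 0
    rw [hz]
    refine tendsto_nhds_unique (hlimg _ C hC) (tendsto_const_nhds.congr fun n => ?_)
    rw [← hzero' n, ← hfy, hT]
  have hcon : ε ≤ ‖ψ z‖ := ge_of_tendsto (hψ z).norm (.of_forall fun m => by
    rw [hzL]
    exact hL m)
  rw [hψz, norm_zero] at hcon
  exact hε.not_ge hcon

end SetwiseC0

theorem theoremt {𝕜 : Type*} [RCLike 𝕜] {E : Type*} [TopologicalSpace E] [T2Space E]
    [LocallyCompactSpace E] [MeasurableSpace E] [BorelSpace E]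
    (T : C₀(E, 𝕜) →L[𝕜] C₀(E, 𝕜)) :
    (∀ k₁ k₂ : BoundedKernel 𝕜 E, IsKernelOf k₁ T → IsKernelOf k₂ T → k₁ = k₂) ∧
    (IsWeaklyCompactOperator T ↔
      ∃ k : BoundedKernel 𝕜 E, IsKernelOf k T ∧
        ∀ A : Set E, MeasurableSet A → MemC0 fun x => k.toMeasure x A) ∧
    (IsCompactOperator T ↔
      ∃ k : BoundedKernel 𝕜 E, IsKernelOf k T ∧
        k.IsTVContinuous ∧ MemC0 fun x => tvNorm (k.toMeasure x)) := by
  refine ⟨fun _ _ => IsKernelOf.unique, ⟨fun hT => hT.exists_kernel, ?_⟩, fun hT => ?_, ?_⟩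
  · rintro ⟨k, hk, hC0⟩
    exact hk.isWeaklyCompactOperator hC0
  · obtain ⟨k, hk, -⟩ := hT.isWeaklyCompactOperator.exists_kernel
    exact ⟨k, hk, hT.isTVContinuous hk, hT.memC0_tvNorm hk⟩
  · rintro ⟨k, hk, hcont, h0⟩
    exact hk.isCompactOperator hcont h0
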